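/- Let $G:\mathbb R\to\mathbb R$ be a stationary Gaussian random field of mean zero on a probability space, with covariance function $\mathcal C:\mathbb R\to\mathbb R$, i.e. $\mathbb E[G(x)G(y)]=\mathcal C(x-y)$ for all $x,y\in\mathbb R$. Assume that $\mathcal C$ is Hölder continuous at zero (there are $\alpha,\delta>0$ and $K<\infty$ with $|\mathcal C(x)-\mathcal C(0)|\le K|x|^\alpha$ for $|x|<\delta$) and that there are $\beta>0$ and $K'<\infty$ with $|\mathcal C(x)|\le K'(1+|x|)^{-\beta}$ for all $x\in\mathbb R$. Then $G$ has a modification with almost surely continuous realizations; let $G$ from now on denote any such modification, and set $a(x):=\exp(G(x))$ and $\bar a:=\exp(-\tfrac12\mathcal C(0))>0$. Let $f\in C^1([0,1])$ be deterministic. Then the problem $$(\bar a\,\bar u'(x))'=f'(x)\ \text{ on }(0,1),\qquad \bar u(0)=\bar u(1)=0,$$ has a unique solution $\bar u\in C^1([0,1])$; almost surely, for every $\varepsilon>0$ the problem $$\big(a(\tfrac x\varepsilon)\,u_\varepsilon'(x)\big)'=f'(x)\ \text{ on }(0,1),\qquad u_\varepsilon(0)=u_\varepsilon(1)=0,$$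 has a unique solution $u_\varepsilon\in C^1([0,1])$; and almost surely, for all $x\in[0,1]$, $$\lim_{\varepsilon\downarrow0}\Big(u_\varepsilon'(x)-\bar u'(x)\,\frac{\bar a}{a(\frac x\varepsilon)}\Big)=0 ,$$ where derivatives at $x=0$ and $x=1$ are one-sided. -/

import Mathlib

open MeasureTheory ProbabilityTheory Filter Topology Set

/-- `G` is a stationary Gaussian random field on `ℝ` of mean zero whose covariance function
is `C`, that is, `𝔼[G(x) G(y)] = C (x - y)`. -/
structure IsStationaryGaussianField {Ω : Type*} [MeasurableSpace Ω] (G : ℝ → Ω → ℝ)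
    (C : ℝ → ℝ) (P : Measure Ω) : Prop where
  gaussian : IsGaussianProcess G P
  mean_zero : ∀ x, ∫ ω, G x ω ∂P = 0
  covariance : ∀ x y, ∫ ω, G x ω * G y ω ∂P = C (x - y)

/-- `C` is Hölder continuous at the point zero, for some positive exponent. -/
def HolderAtZero (C : ℝ → ℝ) : Prop :=
  ∃ α : ℝ, 0 < α ∧ ∃ K δ : ℝ, 0 < δ ∧ ∀ x : ℝ, |x| < δ → |C x - C 0| ≤ K * |x| ^ α

/-- Algebraic decay `|C x| ≲ (1 + |x|) ^ (-β)`. -/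
def DecaysWithRate (C : ℝ → ℝ) (β : ℝ) : Prop :=
  ∃ K : ℝ, ∀ x : ℝ, |C x| ≤ K * (1 + |x|) ^ (-β)

/-- `H` is a modification of the field `G` with almost surely continuous realizations. -/
structure IsContinuousModification {Ω : Type*} [MeasurableSpace Ω] (H G : ℝ → Ω → ℝ)
    (P : Measure Ω) : Prop where
  modification : ∀ x, H x =ᵐ[P] G x
  continuous : ∀ᵐ ω ∂P, Continuous (fun x => H x ω)

/-- `u ∈ C¹([0,1])` solves `(A u')' = f'` on `(0,1)` with `u 0 = 0` and `u 1 = 0`.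
The derivative `u'` is one-sided at the two endpoints. -/
structure IsSolution (A f u : ℝ → ℝ) : Prop where
  contDiffOn : ContDiffOn ℝ 1 u (Icc 0 1)
  equation : ∀ x ∈ Ioo (0 : ℝ) 1,
    HasDerivAt (fun y => A y * derivWithin u (Icc 0 1) y) (deriv f x) x
  left : u 0 = 0
  right : u 1 = 0

/-- The Dirichlet problem for `(A u')' = f'` on `(0,1)` has exactly one solution
(as a function on `[0,1]`). -/
def WellPosed (A f : ℝ → ℝ) : Prop :=
  ∃ u, IsSolution A f u ∧ ∀ v, IsSolution A f v → EqOn v u (Icc 0 1)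

/-! The Dirichlet problem is solved by one quadrature: `a(x/ε) u_ε' = f + c_ε`, where the
constant `c_ε` is fixed by `∫₀¹ u_ε' = 0`, and likewise `ā ū' = f + c̄`. Hence
`u_ε'(x) - ū'(x) ā / a(x/ε) = (c_ε - c̄) exp(-G(x/ε))`, and two facts about `-G`, a field of
the same kind as `G`, compete.

Decay of the covariance makes the variance of the time averages of `exp(-G)` decay algebraically,
so these averages satisfy a law of large numbers with a rate; integration by parts against
`f ∈ C¹` turns it into `c_ε - c̄ = O(ε ^ γ)` for some `γ > 0`.

The other factor may be unbounded as `ε → 0`. Kolmogorov's chaining over the dyadic points of the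
whole line, where all moments of a Gaussian field are available, gives both the continuous
modification and the bound `exp(-G(y)) = O((1 + |y|) ^ s)` for every `s > 0`; any `s < γ`
suffices. -/

section Moments

variable {Ω ι E : Type*} [MeasurableSpace Ω] {P : Measure Ω} [NormedAddCommGroup E] [Countable ι]
  {X : ι → Ω → E} {c w : ι → ℝ} {p : ℕ}

lemma ae_exists_norm_le_of_summable_pow (hp : p ≠ 0) (hX : ∀ i, AEStronglyMeasurable (X i) P)
    (hc : ∀ i, 0 ≤ c i) (hXc : ∀ i, eLpNorm (X i) p P ≤ ENNReal.ofReal (c i))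
    (hsum : Summable fun i => c i ^ p) :
    ∀ᵐ ω ∂P, ∃ M, 0 ≤ M ∧ ∀ i, ‖X i ω‖ ≤ M := by
  have hmoment (i : ι) : ∫⁻ ω, ‖X i ω‖ₑ ^ p ∂P ≤ ENNReal.ofReal (c i ^ p) := by
    have h := eLpNorm_nnreal_pow_eq_lintegral (f := X i) (μ := P) (p := p) (mod_cast hp)
    simp only [NNReal.coe_natCast, ENNReal.rpow_natCast, ENNReal.coe_natCast] at h
    rw [← h, ENNReal.ofReal_pow (hc i)]
    gcongr
    exact hXc i
  have hmeas (i : ι) : AEMeasurable (fun ω => ‖X i ω‖ₑ ^ p) P := (hX i).enorm.pow_const p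
  have hfin : ∫⁻ ω, ∑' i, ‖X i ω‖ₑ ^ p ∂P ≠ ⊤ := by
    rw [lintegral_tsum hmeas]
    exact ne_top_of_le_ne_top hsum.tsum_ofReal_ne_top (ENNReal.tsum_le_tsum hmoment)
  filter_upwards [ae_lt_top' (.tsum hmeas) hfin] with ω hω
  set S := ∑' i, ‖X i ω‖ₑ ^ p
  refine ⟨1 + S.toReal, by positivity, fun i => ?_⟩
  have hterm : ‖X i ω‖ ^ p ≤ S.toReal := by
    simpa using ENNReal.toReal_mono hω.ne (ENNReal.le_tsum i)
  refine le_of_pow_le_pow_left₀ hp (by positivity) ?_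
  calc ‖X i ω‖ ^ p ≤ 1 + S.toReal := by linarith
    _ ≤ (1 + S.toReal) ^ p := le_self_pow₀ (by linarith [S.toReal_nonneg]) hp

lemma ae_exists_norm_le_mul_of_summable_pow [NormedSpace ℝ E] (hp : p ≠ 0)
    (hX : ∀ i, AEStronglyMeasurable (X i) P) (hc : ∀ i, 0 ≤ c i) (hw : ∀ i, 0 < w i)
    (hXc : ∀ i, eLpNorm (X i) p P ≤ ENNReal.ofReal (c i))
    (hsum : Summable fun i => (c i / w i) ^ p) :
    ∀ᵐ ω ∂P, ∃ M, 0 ≤ M ∧ ∀ i, ‖X i ω‖ ≤ M * w i := by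
  have hscaled (i : ι) : eLpNorm ((w i)⁻¹ • X i) p P ≤ ENNReal.ofReal (c i / w i) := by
    rw [eLpNorm_const_smul, Real.enorm_of_nonneg (inv_nonneg.2 (hw i).le), div_eq_inv_mul,
      ENNReal.ofReal_mul (inv_nonneg.2 (hw i).le)]
    gcongr
    exact hXc i
  filter_upwards [ae_exists_norm_le_of_summable_pow hp (fun i => (hX i).const_smul _)
    (fun i => div_nonneg (hc i) (hw i).le) hscaled hsum] with ω ⟨M, hM, h⟩
  refine ⟨M, hM, fun i => ?_⟩
  have := h i
  rwa [Pi.smul_apply, norm_smul, norm_inv, Real.norm_of_nonneg (hw i).le,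
    inv_mul_le_iff₀ (hw i), mul_comm] at this

end Moments

section Chaining

/-- The largest multiple of `2⁻ᵏ` not exceeding `x`. -/
noncomputable def dyadicFloor (k : ℕ) (x : ℝ) : ℝ := (⌊2 ^ k * x⌋ : ℝ) / 2 ^ k

lemma dyadicFloor_le (k : ℕ) (x : ℝ) : dyadicFloor k x ≤ x := by
  rw [dyadicFloor, div_le_iff₀ (by positivity), mul_comm]
  exact Int.floor_le _

lemma lt_dyadicFloor_add (k : ℕ) (x : ℝ) : x < dyadicFloor k x + (1 / 2) ^ k := by
  rw [dyadicFloor, one_div, inv_pow, ← one_div, ← add_div, lt_div_iff₀ (by positivity), mul_comm]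
  exact Int.lt_floor_add_one _

lemma abs_sub_dyadicFloor_le (k : ℕ) (x : ℝ) : |x - dyadicFloor k x| ≤ (1 / 2) ^ k := by
  rw [abs_of_nonneg (sub_nonneg.2 (dyadicFloor_le k x))]
  linarith [lt_dyadicFloor_add k x]

lemma tendsto_dyadicFloor (x : ℝ) : Tendsto (dyadicFloor · x) atTop (𝓝 x) := by
  rw [tendsto_iff_dist_tendsto_zero]
  refine squeeze_zero (fun _ => dist_nonneg) (fun k => ?_)
    (tendsto_pow_atTop_nhds_zero_of_lt_one (r := (1 / 2 : ℝ)) (by norm_num) (by norm_num))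
  rw [dist_comm, Real.dist_eq]
  exact abs_sub_dyadicFloor_le k x

lemma abs_dyadicFloor_le (k : ℕ) (x : ℝ) : |dyadicFloor k x| ≤ 1 + |x| := by
  have hgap : |x - dyadicFloor k x| ≤ 1 :=
    (abs_sub_dyadicFloor_le k x).trans (pow_le_one₀ (by norm_num) (by norm_num))
  linarith [abs_sub_abs_le_abs_sub (dyadicFloor k x) x, abs_sub_comm x (dyadicFloor k x)]

lemma dyadicFloor_eq_or_eq_add {k : ℕ} {x y : ℝ} (hxy : x ≤ y)
    (hyx : y < dyadicFloor k x + 2 * (1 / 2) ^ k) :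
    dyadicFloor k y = dyadicFloor k x ∨ dyadicFloor k y = (⌊2 ^ k * x⌋ + 1) / 2 ^ k := by
  have hlow : ⌊2 ^ k * x⌋ ≤ ⌊2 ^ k * y⌋ := Int.floor_le_floor (by gcongr)
  have hupp : ⌊2 ^ k * y⌋ < ⌊2 ^ k * x⌋ + 2 := by
    have hsum : dyadicFloor k x + 2 * (1 / 2) ^ k = (⌊2 ^ k * x⌋ + 2) / 2 ^ k := by
      rw [dyadicFloor, one_div, inv_pow]; ring
    rw [hsum, lt_div_iff₀ (by positivity), mul_comm] at hyx
    exact Int.floor_lt.2 (by push_cast; exact hyx)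
  obtain hf | hf : ⌊2 ^ k * y⌋ = ⌊2 ^ k * x⌋ ∨ ⌊2 ^ k * y⌋ = ⌊2 ^ k * x⌋ + 1 := by omega
  · exact .inl (by rw [dyadicFloor, dyadicFloor, hf])
  · exact .inr (by rw [dyadicFloor, hf]; push_cast; rfl)

lemma dyadicFloor_succ_dyadicFloor (k : ℕ) (x : ℝ) :
    dyadicFloor (k + 1) (dyadicFloor k x) = dyadicFloor k x := by
  have hint : (2 : ℝ) ^ (k + 1) * dyadicFloor k x = ((2 * ⌊2 ^ k * x⌋ : ℤ) : ℝ) := by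
    rw [dyadicFloor, pow_succ]; push_cast; field_simp
  rw [dyadicFloor, hint, Int.floor_intCast, ← hint]
  field_simp

/-- The increments of `φ` over dyadic intervals of length `2⁻ᵏ` are at most `B θᵏ`, up to a factor
growing in space like the power `s`; this is what a chaining argument needs to know about `φ`. -/
def DyadicIncrementBound (φ : ℝ → ℝ) (B s θ : ℝ) : Prop :=
  ∀ (k : ℕ) (i : ℤ), |φ ((i + 1) / 2 ^ k) - φ (i / 2 ^ k)| ≤ B * (1 + |(i : ℝ) / 2 ^ k|) ^ s * θ ^ k

namespace DyadicIncrementBound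

variable {φ ψ : ℝ → ℝ} {B s θ : ℝ}

lemma abs_sub_dyadicFloor_le (h : DyadicIncrementBound φ B s θ) (hB : 0 ≤ B) (hθ : 0 ≤ θ)
    {k : ℕ} {x y : ℝ} (hxy : x ≤ y) (hyx : y < dyadicFloor k x + 2 * (1 / 2) ^ k) :
    |φ (dyadicFloor k y) - φ (dyadicFloor k x)| ≤ B * (1 + |dyadicFloor k x|) ^ s * θ ^ k := by
  obtain hy | hy := dyadicFloor_eq_or_eq_add hxy hyx
  · rw [hy, sub_self, abs_zero]; positivity
  · rw [hy]; exact h k _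

lemma abs_sub_dyadicFloor_succ_le (h : DyadicIncrementBound φ B s θ) (hB : 0 ≤ B) (hs : 0 ≤ s)
    (hθ : 0 ≤ θ) (hθ1 : θ < 1) (k : ℕ) (x : ℝ) :
    |φ (dyadicFloor k x) - φ (dyadicFloor (k + 1) x)| ≤ B * (2 + |x|) ^ s * θ ^ k := by
  have hrefine := h.abs_sub_dyadicFloor_le hB hθ (k := k + 1) (dyadicFloor_le k x) (by
    rw [dyadicFloor_succ_dyadicFloor]
    convert lt_dyadicFloor_add k x using 2
    ring)
  rw [dyadicFloor_succ_dyadicFloor, abs_sub_comm] at hrefine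
  refine hrefine.trans ?_
  have hgrowth : 1 + |dyadicFloor k x| ≤ 2 + |x| := by linarith [abs_dyadicFloor_le k x]
  gcongr ?_ * ?_ ^ s * ?_
  exact pow_le_pow_of_le_one hθ hθ1.le k.le_succ

lemma exists_tendsto (h : DyadicIncrementBound φ B s θ) (hB : 0 ≤ B) (hs : 0 ≤ s) (hθ : 0 ≤ θ)
    (hθ1 : θ < 1) (x : ℝ) :
    ∃ l, Tendsto (fun k => φ (dyadicFloor k x)) atTop (𝓝 l) :=
  cauchySeq_tendsto_of_complete (cauchySeq_of_le_geometric θ _ hθ1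
    (h.abs_sub_dyadicFloor_succ_le hB hs hθ hθ1 · x))

lemma abs_sub_limit_le (h : DyadicIncrementBound φ B s θ) (hB : 0 ≤ B) (hs : 0 ≤ s) (hθ : 0 ≤ θ)
    (hθ1 : θ < 1) {x l : ℝ} (hl : Tendsto (fun k => φ (dyadicFloor k x)) atTop (𝓝 l)) (k : ℕ) :
    |φ (dyadicFloor k x) - l| ≤ B * (2 + |x|) ^ s * θ ^ k / (1 - θ) :=
  dist_le_of_le_geometric_of_tendsto θ _ hθ1 (h.abs_sub_dyadicFloor_succ_le hB hs hθ hθ1 · x) hl k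

lemma abs_limit_sub_limit_le (h : DyadicIncrementBound φ B s θ) (hB : 0 ≤ B) (hs : 0 ≤ s)
    (hθ : 0 ≤ θ) (hθ1 : θ < 1)
    (hψ : ∀ x, Tendsto (fun k => φ (dyadicFloor k x)) atTop (𝓝 (ψ x)))
    {R : ℝ} {k : ℕ} {x y : ℝ} (hx : |x| ≤ R) (hy : |y| ≤ R) (hxy : |y - x| ≤ (1 / 2) ^ k) :
    |ψ y - ψ x| ≤ B * (2 + R) ^ s * (2 / (1 - θ) + 1) * θ ^ k := by
  wlog hle : x ≤ y generalizing x y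
  · rw [abs_sub_comm]
    exact this hy hx (by rwa [abs_sub_comm]) (le_of_not_ge hle)
  have : 0 < 1 - θ := by linarith
  have hlimit {z : ℝ} (hz : |z| ≤ R) :
      |φ (dyadicFloor k z) - ψ z| ≤ B * (2 + R) ^ s * θ ^ k / (1 - θ) :=
    (h.abs_sub_limit_le hB hs hθ hθ1 (hψ z) k).trans (by gcongr)
  have hstep : |φ (dyadicFloor k y) - φ (dyadicFloor k x)| ≤ B * (2 + R) ^ s * θ ^ k := by
    have hgap : y < dyadicFloor k x + 2 * (1 / 2) ^ k := by
      linarith [(abs_le.1 hxy).2, lt_dyadicFloor_add k x]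
    refine (h.abs_sub_dyadicFloor_le hB hθ hle hgap).trans ?_
    have hgrowth : 1 + |dyadicFloor k x| ≤ 2 + R := by linarith [abs_dyadicFloor_le k x]
    gcongr
  calc |ψ y - ψ x| = |(φ (dyadicFloor k y) - φ (dyadicFloor k x)) + (φ (dyadicFloor k x) - ψ x)
        - (φ (dyadicFloor k y) - ψ y)| := by ring_nf
    _ ≤ |φ (dyadicFloor k y) - φ (dyadicFloor k x)| + |φ (dyadicFloor k x) - ψ x|
        + |φ (dyadicFloor k y) - ψ y| := (abs_sub _ _).trans (by gcongr; exact abs_add_le _ _)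
    _ ≤ B * (2 + R) ^ s * θ ^ k + B * (2 + R) ^ s * θ ^ k / (1 - θ)
        + B * (2 + R) ^ s * θ ^ k / (1 - θ) := by gcongr <;> [exact hlimit hx; exact hlimit hy]
    _ = B * (2 + R) ^ s * (2 / (1 - θ) + 1) * θ ^ k := by ring

lemma continuous_limit (h : DyadicIncrementBound φ B s θ) (hB : 0 ≤ B) (hs : 0 ≤ s) (hθ : 0 ≤ θ)
    (hθ1 : θ < 1)
    (hψ : ∀ x, Tendsto (fun k => φ (dyadicFloor k x)) atTop (𝓝 (ψ x))) : Continuous ψ := by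
  refine Metric.continuous_iff.2 fun x ε hε => ?_
  have hmodulus : Tendsto (B * (2 + (1 + |x|)) ^ s * (2 / (1 - θ) + 1) * θ ^ ·) atTop (𝓝 0) := by
    simpa using (tendsto_pow_atTop_nhds_zero_of_lt_one hθ hθ1).const_mul
      (B * (2 + (1 + |x|)) ^ s * (2 / (1 - θ) + 1))
  obtain ⟨k, hk⟩ := (hmodulus.eventually (gt_mem_nhds hε)).exists
  refine ⟨(1 / 2) ^ k, by positivity, fun y hy => ?_⟩
  rw [Real.dist_eq] at hy ⊢
  have hy1 : |y| ≤ 1 + |x| := by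
    have hpow : (1 / 2 : ℝ) ^ k ≤ 1 := pow_le_one₀ (by norm_num) (by norm_num)
    linarith [abs_sub_abs_le_abs_sub y x]
  exact (h.abs_limit_sub_limit_le hB hs hθ hθ1 hψ (by linarith) hy1 hy.le).trans_lt hk

lemma abs_le_of_continuous (h : DyadicIncrementBound φ B s θ) (hB : 0 ≤ B) (hs : 0 ≤ s) (hθ : 0 ≤ θ)
    (hθ1 : θ < 1) (hφ : Continuous φ) (x : ℝ) :
    |φ x| ≤ |φ ⌊x⌋| + B * (2 + |x|) ^ s / (1 - θ) := by
  have hlim := h.abs_sub_limit_le hB hs hθ hθ1 ((hφ.tendsto x).comp (tendsto_dyadicFloor x)) 0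
  simp only [dyadicFloor, pow_zero, one_mul, div_one, mul_one] at hlim
  linarith [abs_sub_abs_le_abs_sub (φ x) (φ ⌊x⌋), abs_sub_comm (φ x) (φ ⌊x⌋)]

end DyadicIncrementBound

end Chaining

section Kolmogorov

variable {Ω : Type*} [MeasurableSpace Ω] {P : Measure Ω} {Z : ℝ → Ω → ℝ} {η s : ℝ}

/-- The field `Z` is, in every `L^p` with `p` finite, a Hölder continuous function of exponent `η`
on intervals of length `1`. This is the input for Kolmogorov's continuity criterion; natural
exponents `p` suffice because they are unbounded. -/
structure IsLpHolder (Z : ℝ → Ω → ℝ) (η : ℝ) (P : Measure Ω) : Prop where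
  aestronglyMeasurable : ∀ x, AEStronglyMeasurable (Z x) P
  increment : ∀ p : ℕ, ∃ K, 0 ≤ K ∧ ∀ x y, |x - y| ≤ 1 →
    eLpNorm (Z x - Z y) p P ≤ ENNReal.ofReal (K * |x - y| ^ η)

/-- The variables `Z x` are bounded in every `L^p` with `p` finite, uniformly in `x`. -/
def HasBoundedMoments (Z : ℝ → Ω → ℝ) (P : Measure Ω) : Prop :=
  ∀ p : ℕ, ∃ K, 0 ≤ K ∧ ∀ x, eLpNorm (Z x) p P ≤ ENNReal.ofReal K

lemma summable_int_one_add_abs_inv_sq : Summable fun i : ℤ => ((1 + |(i : ℝ)|) ^ 2)⁻¹ := by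
  have hnat : Summable fun n : ℕ => ((1 + (n : ℝ)) ^ 2)⁻¹ :=
    ((summable_nat_add_iff 1).2 (Real.summable_nat_pow_inv.2 one_lt_two)).congr fun n => by
      rw [Nat.cast_add_one, add_comm]
  exact .of_nat_of_neg (by simpa using hnat) (by simpa using hnat)

lemma rpow_pow_le_inv_sq {a : ℝ} {p : ℕ} (ha : 1 ≤ a) (hp : 2 ≤ s * p) :
    ((a ^ s) ^ p)⁻¹ ≤ (a ^ 2)⁻¹ := by
  have hpow : a ^ 2 ≤ (a ^ s) ^ p := by
    rw [← Real.rpow_mul_natCast (by linarith), ← Real.rpow_natCast a 2]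
    exact Real.rpow_le_rpow_of_exponent_le ha (mod_cast hp)
  gcongr

lemma half_rpow_lt_one (hη : 0 < η) : (1 / 2 : ℝ) ^ (η / 2) < 1 :=
  Real.rpow_lt_one (by norm_num) (by norm_num) (by positivity)

lemma dyadic_increment_weight_le {K : ℝ} {p : ℕ} (hK : 0 ≤ K) (hp : 2 ≤ s * p) (hη : 6 ≤ η * p)
    (k : ℕ) (i : ℤ) :
    (K * ((1 / 2) ^ k) ^ η / ((1 + |(i : ℝ) / 2 ^ k|) ^ s * ((1 / 2) ^ (η / 2)) ^ k)) ^ p ≤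
      (1 / 2) ^ k * (K ^ p * ((1 + |(i : ℝ)|) ^ 2)⁻¹) := by
  set δ : ℝ := (1 / 2) ^ k with hδ
  have hδ0 : 0 < δ := by positivity
  have hδ1 : δ ≤ 1 := pow_le_one₀ (by norm_num) (by norm_num)
  have hθ : (((1 : ℝ) / 2) ^ (η / 2)) ^ k = δ ^ (η / 2) := by
    rw [hδ, ← Real.rpow_mul_natCast (by norm_num), ← Real.rpow_natCast_mul (by norm_num), mul_comm]
  have hratio : δ ^ η / δ ^ (η / 2) = δ ^ (η / 2) := by
    rw [← Real.rpow_sub hδ0]; ring_nf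
  have htime : (δ ^ (η / 2)) ^ p ≤ δ ^ 3 := by
    rw [← Real.rpow_mul_natCast hδ0.le, ← Real.rpow_natCast δ 3]
    exact Real.rpow_le_rpow_of_exponent_ge hδ0 hδ1 (by push_cast; linarith)
  have hspace : (((1 + |(i : ℝ) / 2 ^ k|) ^ s) ^ p)⁻¹ ≤ (δ ^ 2)⁻¹ * ((1 + |(i : ℝ)|) ^ 2)⁻¹ := by
    refine (rpow_pow_le_inv_sq (by simp) hp).trans ?_
    rw [← mul_inv, ← mul_pow]
    have hdiv : |(i : ℝ) / 2 ^ k| = δ * |(i : ℝ)| := by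
      rw [abs_div, abs_of_pos (by positivity : (0 : ℝ) < 2 ^ k), hδ, one_div_pow, div_eq_inv_mul,
        one_div]
    gcongr
    rw [hdiv, mul_add]
    linarith
  calc (K * δ ^ η / ((1 + |(i : ℝ) / 2 ^ k|) ^ s * ((1 / 2) ^ (η / 2)) ^ k)) ^ p
      = K ^ p * ((1 + |(i : ℝ) / 2 ^ k|) ^ s)⁻¹ ^ p * (δ ^ (η / 2)) ^ p := by
        rw [hθ, mul_div_mul_comm, hratio, mul_pow, div_eq_mul_inv, mul_pow]
    _ ≤ K ^ p * ((δ ^ 2)⁻¹ * ((1 + |(i : ℝ)|) ^ 2)⁻¹) * δ ^ 3 := by rw [inv_pow]; gcongr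
    _ = δ * (K ^ p * ((1 + |(i : ℝ)|) ^ 2)⁻¹) := by field_simp

lemma abs_exp_sub_exp_le (a b : ℝ) :
    |Real.exp a - Real.exp b| ≤ Real.exp (max a b) * |a - b| := by
  wlog hab : b ≤ a generalizing a b
  · rw [abs_sub_comm, max_comm, abs_sub_comm a]
    exact this b a (le_of_not_ge hab)
  have hfactor : Real.exp b = Real.exp a * Real.exp (b - a) := by rw [← Real.exp_add]; ring_nf
  rw [max_eq_left hab, abs_of_nonneg (sub_nonneg.2 (Real.exp_le_exp.2 hab)),
    abs_of_nonneg (sub_nonneg.2 hab), hfactor]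
  nlinarith [Real.exp_pos a, Real.add_one_le_exp (b - a)]

namespace IsLpHolder

lemma ae_dyadicIncrementBound (hZ : IsLpHolder Z η P) (hη : 0 < η) (hs : 0 < s) :
    ∀ᵐ ω ∂P, ∃ B, 0 ≤ B ∧ DyadicIncrementBound (Z · ω) B s ((1 / 2) ^ (η / 2)) := by
  obtain ⟨p, hp⟩ := exists_nat_ge (max (2 / s) (6 / η))
  have hps : 2 ≤ s * p := by rw [← div_le_iff₀' hs]; exact (le_max_left _ _).trans hp
  have hpη : 6 ≤ η * p := by rw [← div_le_iff₀' hη]; exact (le_max_right _ _).trans hp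
  have hp0 : p ≠ 0 := by rintro rfl; norm_num at hps
  obtain ⟨K, hK, hincr⟩ := hZ.increment p
  let X : ℕ × ℤ → Ω → ℝ := fun q => Z ((q.2 + 1) / 2 ^ q.1) - Z (q.2 / 2 ^ q.1)
  let c : ℕ × ℤ → ℝ := fun q => K * ((1 / 2) ^ q.1) ^ η
  let w : ℕ × ℤ → ℝ := fun q => (1 + |(q.2 : ℝ) / 2 ^ q.1|) ^ s * ((1 / 2) ^ (η / 2)) ^ q.1
  have hXc (q : ℕ × ℤ) : eLpNorm (X q) p P ≤ ENNReal.ofReal (c q) := by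
    have hgap : |((q.2 : ℝ) + 1) / 2 ^ q.1 - q.2 / 2 ^ q.1| = (1 / 2) ^ q.1 := by
      rw [← sub_div, add_sub_cancel_left, abs_of_pos (by positivity), one_div_pow]
    have h := hincr ((q.2 + 1) / 2 ^ q.1) (q.2 / 2 ^ q.1)
      (hgap.trans_le (pow_le_one₀ (by norm_num) (by norm_num)))
    rwa [hgap] at h
  have hsum : Summable fun q => (c q / w q) ^ p := by
    refine .of_nonneg_of_le (fun q => by positivity)
      (fun q => dyadic_increment_weight_le hK hps hpη q.1 q.2) ?_
    exact Summable.mul_of_nonneg (f := fun k : ℕ => (1 / 2 : ℝ) ^ k)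
      (summable_geometric_of_lt_one (by norm_num) (by norm_num))
      (summable_int_one_add_abs_inv_sq.mul_left (K ^ p))
      (fun k => by positivity) (fun i => by positivity)
  filter_upwards [ae_exists_norm_le_mul_of_summable_pow hp0
    (fun q => (hZ.aestronglyMeasurable _).sub (hZ.aestronglyMeasurable _))
    (fun q => by positivity) (fun q => by positivity) hXc hsum] with ω ⟨B, hB, h⟩
  exact ⟨B, hB, fun k i => (h (k, i)).trans_eq (mul_assoc _ _ _).symm⟩

lemma exists_seq_tendsto_ae (hZ : IsLpHolder Z η P) (hη : 0 < η) (x : ℝ) :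
    ∃ ns : ℕ → ℕ, StrictMono ns ∧
      ∀ᵐ ω ∂P, Tendsto (fun j => Z (dyadicFloor (ns j) x) ω) atTop (𝓝 (Z x ω)) := by
  suffices TendstoInMeasure P (fun k => Z (dyadicFloor k x)) atTop (Z x) from
    this.exists_seq_tendsto_ae
  obtain ⟨K, -, hincr⟩ := hZ.increment 1
  refine tendstoInMeasure_of_tendsto_eLpNorm (p := (1 : ℕ)) (by simp)
    (fun _ => hZ.aestronglyMeasurable _) (hZ.aestronglyMeasurable x) ?_
  have hbound : Tendsto (fun k => ENNReal.ofReal (K * |dyadicFloor k x - x| ^ η)) atTop (𝓝 0) := by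
    have hgap : Tendsto (fun k => |dyadicFloor k x - x|) atTop (𝓝 0) := by
      simpa using ((tendsto_dyadicFloor x).sub_const x).abs
    simpa [Real.zero_rpow hη.ne'] using
      ENNReal.tendsto_ofReal ((hgap.rpow_const (.inr hη.le)).const_mul K)
  refine tendsto_of_tendsto_of_tendsto_of_le_of_le tendsto_const_nhds hbound (fun _ => zero_le)
    fun k => hincr _ _ ?_
  rw [abs_sub_comm]
  exact (abs_sub_dyadicFloor_le k x).trans (pow_le_one₀ (by norm_num) (by norm_num))

theorem exists_isContinuousModification (hZ : IsLpHolder Z η P) (hη : 0 < η) :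
    ∃ H, IsContinuousModification H Z P := by
  have hθ := half_rpow_lt_one hη
  let H : ℝ → Ω → ℝ := fun x ω => limUnder atTop fun k => Z (dyadicFloor k x) ω
  have hlim : ∀ᵐ ω ∂P, Continuous (H · ω) ∧
      ∀ x, Tendsto (fun k => Z (dyadicFloor k x) ω) atTop (𝓝 (H x ω)) := by
    filter_upwards [hZ.ae_dyadicIncrementBound hη one_pos] with ω ⟨B, hB, h⟩
    have hH (x : ℝ) : Tendsto (fun k => Z (dyadicFloor k x) ω) atTop (𝓝 (H x ω)) :=
      tendsto_nhds_limUnder (h.exists_tendsto hB zero_le_one (by positivity) hθ x)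
    exact ⟨h.continuous_limit hB zero_le_one (by positivity) hθ hH, hH⟩
  refine ⟨H, fun x => ?_, hlim.mono fun ω h => h.1⟩
  obtain ⟨ns, hns, hx⟩ := hZ.exists_seq_tendsto_ae hη x
  filter_upwards [hlim, hx] with ω hω hxω
  exact tendsto_nhds_unique ((hω.2 x).comp hns.tendsto_atTop) hxω

theorem ae_exists_abs_le_mul_rpow (hZ : IsLpHolder Z η P) (hη : 0 < η)
    (hmom : HasBoundedMoments Z P) (hcont : ∀ᵐ ω ∂P, Continuous (Z · ω)) (hs : 0 < s) :
    ∀ᵐ ω ∂P, ∃ M, ∀ x, |Z x ω| ≤ M * (2 + |x|) ^ s := by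
  obtain ⟨p, hp⟩ := exists_nat_ge (2 / s)
  have hps : 2 ≤ s * p := by rwa [← div_le_iff₀' hs]
  have hp0 : p ≠ 0 := by rintro rfl; norm_num at hps
  obtain ⟨K, hK, hZK⟩ := hmom p
  have hsum : Summable fun i : ℤ => (K / (1 + |(i : ℝ)|) ^ s) ^ p := by
    refine .of_nonneg_of_le (fun i => by positivity) (fun i => ?_)
      (summable_int_one_add_abs_inv_sq.mul_left (K ^ p))
    rw [div_pow, div_eq_mul_inv]
    gcongr K ^ p * ?_
    exact rpow_pow_le_inv_sq (by simp) hps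
  filter_upwards [hcont, hZ.ae_dyadicIncrementBound hη hs,
    ae_exists_norm_le_mul_of_summable_pow hp0 (fun i : ℤ => hZ.aestronglyMeasurable i)
      (fun _ => hK) (fun i => by positivity) (fun i => hZK i) hsum]
    with ω hω ⟨B, hB, hdyadic⟩ ⟨M, hM, hint⟩
  refine ⟨M + B / (1 - (1 / 2) ^ (η / 2)), fun x => ?_⟩
  have hfloor : 1 + |(⌊x⌋ : ℝ)| ≤ 2 + |x| := by
    have h := abs_dyadicFloor_le 0 x
    rw [dyadicFloor, pow_zero, one_mul, div_one] at h
    linarith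
  calc |Z x ω| ≤ |Z ⌊x⌋ ω| + B * (2 + |x|) ^ s / (1 - (1 / 2) ^ (η / 2)) :=
        hdyadic.abs_le_of_continuous hB hs.le (by positivity) (half_rpow_lt_one hη) hω x
    _ ≤ M * (2 + |x|) ^ s + B * (2 + |x|) ^ s / (1 - (1 / 2) ^ (η / 2)) := by
        gcongr
        exact (hint ⌊x⌋).trans (by gcongr)
    _ = (M + B / (1 - (1 / 2) ^ (η / 2))) * (2 + |x|) ^ s := by ring

lemma exp (hZ : IsLpHolder Z η P) (hexp : HasBoundedMoments (fun x ω => Real.exp (Z x ω)) P) :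
    IsLpHolder (fun x ω => Real.exp (Z x ω)) η P := by
  have hmeas (x : ℝ) : AEStronglyMeasurable (fun ω => Real.exp (Z x ω)) P :=
    Real.continuous_exp.comp_aestronglyMeasurable (hZ.aestronglyMeasurable x)
  refine ⟨hmeas, fun p => ?_⟩
  obtain ⟨A, hA, hexpA⟩ := hexp (p + p)
  obtain ⟨K, hK, hincr⟩ := hZ.increment (p + p)
  refine ⟨(A + A) * K, by positivity, fun x y hxy => ?_⟩
  obtain rfl | hp := Nat.eq_zero_or_pos p
  · simp
  have hsum : eLpNorm (fun ω => Real.exp (Z x ω) + Real.exp (Z y ω)) (p + p : ℕ) P ≤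
      ENNReal.ofReal (A + A) := by
    rw [ENNReal.ofReal_add hA hA]
    exact (eLpNorm_add_le (hmeas x) (hmeas y) (mod_cast by omega)).trans
      (add_le_add (hexpA x) (hexpA y))
  have htriple : ENNReal.HolderTriple (p + p : ℕ) (p + p : ℕ) p := by
    constructor
    rw [Nat.cast_add, ← two_mul (p : ENNReal),
      ENNReal.mul_inv (.inl two_ne_zero) (.inl ENNReal.ofNat_ne_top), ← add_mul,
      ENNReal.inv_two_add_inv_two, one_mul]
  calc eLpNorm (fun ω => Real.exp (Z x ω) - Real.exp (Z y ω)) p P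
      ≤ eLpNorm ((fun ω => Real.exp (Z x ω) + Real.exp (Z y ω)) • (Z x - Z y)) p P := by
        refine eLpNorm_mono fun ω => ?_
        simp only [Pi.smul_apply', Pi.sub_apply, smul_eq_mul, norm_mul, Real.norm_eq_abs]
        refine (abs_exp_sub_exp_le _ _).trans ?_
        gcongr
        rw [abs_of_pos (by positivity)]
        rcases max_cases (Z x ω) (Z y ω) with h | h <;> rw [h.1] <;> simp [Real.exp_nonneg]
    _ ≤ eLpNorm (fun ω => Real.exp (Z x ω) + Real.exp (Z y ω)) (p + p : ℕ) P
        * eLpNorm (Z x - Z y) (p + p : ℕ) P :=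
        eLpNorm_smul_le_mul_eLpNorm
          ((hZ.aestronglyMeasurable x).sub (hZ.aestronglyMeasurable y)) ((hmeas x).add (hmeas y))
    _ ≤ ENNReal.ofReal (A + A) * ENNReal.ofReal (K * |x - y| ^ η) :=
        mul_le_mul' hsum (hincr x y hxy)
    _ = ENNReal.ofReal ((A + A) * K * |x - y| ^ η) := by
        rw [← ENNReal.ofReal_mul (by positivity), mul_assoc]

end IsLpHolder

end Kolmogorov

section CenteredGaussian

variable {Ω : Type*} [MeasurableSpace Ω] {P : Measure Ω} {X : Ω → ℝ}

lemma map_eq_gaussianReal_of_integral_eq_zero (hX : HasGaussianLaw X P)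
    (h0 : ∫ ω, X ω ∂P = 0) : P.map X = gaussianReal 0 Var[X; P].toNNReal := by
  rw [hX.map_eq_gaussianReal, h0]

lemma eLpNorm_eq_sqrt_variance_mul (hX : HasGaussianLaw X P) (h0 : ∫ ω, X ω ∂P = 0)
    (p : ENNReal) :
    eLpNorm X p P = ENNReal.ofReal √Var[X; P] * eLpNorm id p (gaussianReal 0 1) := by
  have hscale : (gaussianReal 0 1).map (√Var[X; P] * ·) = P.map X := by
    rw [map_eq_gaussianReal_of_integral_eq_zero hX h0, gaussianReal_map_const_mul]
    congr 1
    · simp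
    · ext; simp [Real.sq_sqrt (variance_nonneg X P), variance_nonneg]
  calc eLpNorm X p P = eLpNorm id p (P.map X) := by
        rw [eLpNorm_map_measure aestronglyMeasurable_id hX.aemeasurable, Function.id_comp]
    _ = eLpNorm (√Var[X; P] • id) p (gaussianReal 0 1) := by
        rw [← hscale, eLpNorm_map_measure aestronglyMeasurable_id (by fun_prop)]; rfl
    _ = ENNReal.ofReal √Var[X; P] * eLpNorm id p (gaussianReal 0 1) := by
        rw [eLpNorm_const_smul, Real.enorm_of_nonneg (Real.sqrt_nonneg _)]

lemma hasSubgaussianMGF_of_hasGaussianLaw (hX : HasGaussianLaw X P) (h0 : ∫ ω, X ω ∂P = 0) :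
    HasSubgaussianMGF X Var[X; P].toNNReal P where
  integrable_exp_mul t := by
    have h := integrable_exp_mul_gaussianReal (μ := 0) (v := Var[X; P].toNNReal) t
    rw [← map_eq_gaussianReal_of_integral_eq_zero hX h0] at h
    exact h.comp_aemeasurable hX.aemeasurable
  mgf_le t := by
    rw [mgf_gaussianReal (map_eq_gaussianReal_of_integral_eq_zero hX h0) t, zero_mul, zero_add]

lemma integral_exp_of_hasGaussianLaw (hX : HasGaussianLaw X P) (h0 : ∫ ω, X ω ∂P = 0) :
    ∫ ω, Real.exp (X ω) ∂P = Real.exp (Var[X; P] / 2) := by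
  have h := mgf_gaussianReal (map_eq_gaussianReal_of_integral_eq_zero hX h0) 1
  simpa [mgf, variance_nonneg] using h

end CenteredGaussian

namespace IsStationaryGaussianField

variable {Ω : Type*} [MeasurableSpace Ω] {P : Measure Ω} {G H : ℝ → Ω → ℝ} {C : ℝ → ℝ} {β : ℝ}

lemma isProbabilityMeasure (hG : IsStationaryGaussianField G C P) : IsProbabilityMeasure P :=
  hG.gaussian.isProbabilityMeasure

lemma congr_ae (hG : IsStationaryGaussianField G C P) (hH : ∀ x, H x =ᵐ[P] G x) :
    IsStationaryGaussianField H C P where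
  gaussian := hG.gaussian.congr fun x => (hH x).symm
  mean_zero x := by rw [integral_congr_ae (hH x), hG.mean_zero]
  covariance x y := by
    rw [← hG.covariance x y]
    exact integral_congr_ae ((hH x).mul (hH y))

lemma neg (hG : IsStationaryGaussianField G C P) :
    IsStationaryGaussianField (fun x ω => -G x ω) C P where
  gaussian := by
    simpa using! hG.gaussian.smul (fun _ => (-1 : ℝ))
  mean_zero x := by rw [integral_neg, hG.mean_zero, neg_zero]
  covariance x y := by simpa only [neg_mul_neg] using hG.covariance x y

lemma memLp_two (hG : IsStationaryGaussianField G C P) (x : ℝ) : MemLp (G x) 2 P :=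
  (hG.gaussian.hasGaussianLaw_eval x).memLp_two

lemma covariance_eq (hG : IsStationaryGaussianField G C P) (x y : ℝ) :
    cov[G x, G y; P] = C (x - y) := by
  have := hG.isProbabilityMeasure
  rw [covariance_eq_sub (hG.memLp_two x) (hG.memLp_two y), hG.mean_zero, zero_mul, sub_zero]
  exact hG.covariance x y

lemma variance_eq (hG : IsStationaryGaussianField G C P) (x : ℝ) : Var[G x; P] = C 0 := by
  rw [← covariance_self (hG.gaussian.aemeasurable x), hG.covariance_eq, sub_self]

lemma variance_sub (hG : IsStationaryGaussianField G C P) (x y : ℝ) :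
    Var[G x - G y; P] = 2 * (C 0 - C (x - y)) := by
  have := hG.isProbabilityMeasure
  rw [ProbabilityTheory.variance_sub (hG.memLp_two x) (hG.memLp_two y), hG.covariance_eq,
    hG.variance_eq, hG.variance_eq]
  ring

lemma variance_add (hG : IsStationaryGaussianField G C P) (x y : ℝ) :
    Var[G x + G y; P] = 2 * (C 0 + C (x - y)) := by
  have := hG.isProbabilityMeasure
  rw [ProbabilityTheory.variance_add (hG.memLp_two x) (hG.memLp_two y), hG.covariance_eq,
    hG.variance_eq, hG.variance_eq]
  ring

lemma abs_covariance_le (hG : IsStationaryGaussianField G C P) (x : ℝ) : |C x| ≤ C 0 := by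
  have hadd := hG.variance_add x 0 ▸ variance_nonneg _ _
  have hsub := hG.variance_sub x 0 ▸ variance_nonneg _ _
  rw [sub_zero] at hadd hsub
  exact abs_le.2 ⟨by linarith, by linarith⟩

lemma exists_covariance_sub_le (hG : IsStationaryGaussianField G C P) (hC : HolderAtZero C) :
    ∃ α : ℝ, 0 < α ∧ ∃ K, 0 ≤ K ∧ ∀ x, C 0 - C x ≤ K * |x| ^ α := by
  obtain ⟨α, hα, K, δ, hδ, hnear⟩ := hC
  have hC0 : 0 ≤ C 0 := (abs_nonneg _).trans (hG.abs_covariance_le 0)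
  refine ⟨α, hα, |K| + 2 * C 0 / δ ^ α, by positivity, fun x => ?_⟩
  rcases lt_or_ge |x| δ with hx | hx
  · calc C 0 - C x ≤ K * |x| ^ α := by linarith [(abs_le.1 (hnear x hx)).1]
      _ ≤ (|K| + 2 * C 0 / δ ^ α) * |x| ^ α := by
          gcongr
          linarith [le_abs_self K, (by positivity : 0 ≤ 2 * C 0 / δ ^ α)]
  · calc C 0 - C x ≤ 2 * C 0 := by linarith [(abs_le.1 (hG.abs_covariance_le x)).1]
      _ = 2 * C 0 / δ ^ α * δ ^ α := by field_simp
      _ ≤ (|K| + 2 * C 0 / δ ^ α) * |x| ^ α := by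
          gcongr
          linarith [abs_nonneg K]

theorem isLpHolder (hG : IsStationaryGaussianField G C P) (hC : HolderAtZero C) :
    ∃ η, 0 < η ∧ IsLpHolder G η P := by
  obtain ⟨α, hα, K, hK, hincr⟩ := hG.exists_covariance_sub_le hC
  refine ⟨α / 2, by positivity, fun x => (hG.memLp_two x).1, fun p => ?_⟩
  have hfin : eLpNorm id p (gaussianReal 0 1) ≠ ⊤ :=
    (memLp_id_gaussianReal' _ (ENNReal.natCast_ne_top p)).eLpNorm_ne_top
  refine ⟨√(2 * K) * (eLpNorm id p (gaussianReal 0 1)).toReal, by positivity, fun x y _ => ?_⟩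
  have hmean : ∫ ω, (G x - G y) ω ∂P = 0 := by
    simp only [Pi.sub_apply]
    rw [integral_sub (hG.gaussian.hasGaussianLaw_eval x).integrable
      (hG.gaussian.hasGaussianLaw_eval y).integrable, hG.mean_zero, hG.mean_zero, sub_zero]
  have hsqrt : √Var[G x - G y; P] ≤ √(2 * K) * |x - y| ^ (α / 2) := by
    rw [← Real.sqrt_sq (by positivity : (0 : ℝ) ≤ |x - y| ^ (α / 2)),
      ← Real.rpow_mul_natCast (abs_nonneg _), ← Real.sqrt_mul (by positivity), hG.variance_sub]
    refine Real.sqrt_le_sqrt ?_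
    push_cast
    rw [div_mul_cancel₀ _ two_ne_zero]
    linarith [hincr (x - y)]
  rw [eLpNorm_eq_sqrt_variance_mul hG.gaussian.hasGaussianLaw_sub hmean, mul_right_comm,
    ENNReal.ofReal_mul (by positivity), ENNReal.ofReal_toReal hfin]
  gcongr

lemma hasBoundedMoments_exp (hG : IsStationaryGaussianField G C P) :
    HasBoundedMoments (fun x ω => Real.exp (G x ω)) P := fun p => by
  have hnorm (x : ℝ) : eLpNorm (fun ω => Real.exp (G x ω)) p P =
      eLpNorm Real.exp p (gaussianReal 0 (C 0).toNNReal) := by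
    rw [← hG.variance_eq x, ← map_eq_gaussianReal_of_integral_eq_zero
      (hG.gaussian.hasGaussianLaw_eval x) (hG.mean_zero x), eLpNorm_map_measure
      (by fun_prop) (hG.gaussian.aemeasurable x)]
    rfl
  have hfin : eLpNorm Real.exp p (gaussianReal 0 (C 0).toNNReal) ≠ ⊤ := by
    have h := (hasSubgaussianMGF_of_hasGaussianLaw (hG.gaussian.hasGaussianLaw_eval 0)
      (hG.mean_zero 0)).memLp_exp_mul 1 p
    simp only [one_mul] at h
    exact hnorm 0 ▸ h.eLpNorm_ne_top
  exact ⟨_, ENNReal.toReal_nonneg, fun x => by rw [hnorm, ENNReal.ofReal_toReal hfin]⟩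

lemma memLp_two_exp (hG : IsStationaryGaussianField G C P) (x : ℝ) :
    MemLp (fun ω => Real.exp (G x ω)) 2 P := by
  have h := (hasSubgaussianMGF_of_hasGaussianLaw (hG.gaussian.hasGaussianLaw_eval x)
    (hG.mean_zero x)).memLp_exp_mul 1 2
  simpa only [one_mul, ENNReal.coe_ofNat] using h

lemma integral_exp (hG : IsStationaryGaussianField G C P) (x : ℝ) :
    ∫ ω, Real.exp (G x ω) ∂P = Real.exp (C 0 / 2) := by
  rw [integral_exp_of_hasGaussianLaw (hG.gaussian.hasGaussianLaw_eval x) (hG.mean_zero x),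
    hG.variance_eq]

lemma covariance_exp (hG : IsStationaryGaussianField G C P) (x y : ℝ) :
    cov[fun ω => Real.exp (G x ω), fun ω => Real.exp (G y ω); P] =
      Real.exp (C 0) * (Real.exp (C (x - y)) - 1) := by
  have := hG.isProbabilityMeasure
  have hmean : ∫ ω, (G x + G y) ω ∂P = 0 := by
    simp only [Pi.add_apply]
    rw [integral_add (hG.gaussian.hasGaussianLaw_eval x).integrable
      (hG.gaussian.hasGaussianLaw_eval y).integrable, hG.mean_zero, hG.mean_zero, add_zero]
  have hproduct : ∫ ω, Real.exp (G x ω) * Real.exp (G y ω) ∂P = Real.exp (C 0 + C (x - y)) := by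
    simp only [← Real.exp_add]
    refine (integral_exp_of_hasGaussianLaw hG.gaussian.hasGaussianLaw_add hmean).trans ?_
    rw [hG.variance_add]
    ring_nf
  rw [covariance_eq_sub (hG.memLp_two_exp x) (hG.memLp_two_exp y), hG.integral_exp,
    hG.integral_exp, ← Real.exp_add, add_halves, mul_sub, ← Real.exp_add, mul_one, ← hproduct]
  rfl

lemma covariance_exp_le (hG : IsStationaryGaussianField G C P) (x y : ℝ) :
    cov[fun ω => Real.exp (G x ω), fun ω => Real.exp (G y ω); P] ≤
      Real.exp (2 * C 0) * |C (x - y)| := by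
  have hbound := hG.abs_covariance_le (x - y)
  have hmax : max (C (x - y)) 0 ≤ C 0 :=
    max_le (le_of_abs_le hbound) ((abs_nonneg _).trans hbound)
  calc cov[fun ω => Real.exp (G x ω), fun ω => Real.exp (G y ω); P]
      = Real.exp (C 0) * (Real.exp (C (x - y)) - Real.exp 0) := by
        rw [hG.covariance_exp, Real.exp_zero]
    _ ≤ Real.exp (C 0) * (Real.exp (C 0) * |C (x - y)|) := by
        gcongr
        refine (le_abs_self _).trans ((abs_exp_sub_exp_le _ _).trans ?_)
        rw [sub_zero]
        gcongr
    _ = Real.exp (2 * C 0) * |C (x - y)| := by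
        rw [← mul_assoc, ← Real.exp_add, two_mul]

end IsStationaryGaussianField

section TimeAverage

/-- The left Riemann sum of `φ` over `[0, 1]` with `n` equal steps. -/
noncomputable def riemannSum (φ : ℝ → ℝ) (n : ℕ) : ℝ :=
  (n : ℝ)⁻¹ * ∑ i ∈ Finset.range n, φ (i / n)

lemma abs_mul_sub_integral_le {φ : ℝ → ℝ} (hφ : Continuous φ) {a b ε : ℝ} (hab : a ≤ b)
    (hε : ∀ x ∈ Icc a b, |φ a - φ x| ≤ ε) :
    |(b - a) * φ a - ∫ x in a..b, φ x| ≤ (b - a) * ε := by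
  have hconst : (b - a) * φ a - ∫ x in a..b, φ x = ∫ x in a..b, (φ a - φ x) := by
    rw [intervalIntegral.integral_sub intervalIntegrable_const (hφ.intervalIntegrable _ _),
      intervalIntegral.integral_const, smul_eq_mul]
  rw [hconst, mul_comm, ← abs_of_nonneg (sub_nonneg.2 hab), ← Real.norm_eq_abs]
  refine intervalIntegral.norm_integral_le_of_norm_le_const fun x hx => ?_
  rw [uIoc_of_le hab] at hx
  exact hε x (Ioc_subset_Icc_self hx)

lemma abs_riemannSum_sub_integral_le {φ : ℝ → ℝ} (hφ : Continuous φ) {n : ℕ} (hn : 0 < n) {ε : ℝ}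
    (hε : ∀ x ∈ Icc (0 : ℝ) 1, ∀ y ∈ Icc (0 : ℝ) 1, |x - y| ≤ (n : ℝ)⁻¹ → |φ x - φ y| ≤ ε) :
    |riemannSum φ n - ∫ x in (0 : ℝ)..1, φ x| ≤ ε := by
  have hn0 : (0 : ℝ) < n := Nat.cast_pos.2 hn
  let a : ℕ → ℝ := fun i => i / n
  have hstep (i : ℕ) : a (i + 1) - a i = (n : ℝ)⁻¹ := by
    simp only [a]; rw [← sub_div]; push_cast; rw [add_sub_cancel_left, one_div]
  have hle (i : ℕ) : a i ≤ a (i + 1) := by rw [← sub_nonneg, hstep]; positivity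
  have hsplit : ∑ i ∈ Finset.range n, ∫ x in a i..a (i + 1), φ x = ∫ x in (0 : ℝ)..1, φ x := by
    rw [intervalIntegral.sum_integral_adjacent_intervals fun _ _ => hφ.intervalIntegrable _ _]
    simp only [a, Nat.cast_zero, zero_div, div_self hn0.ne']
  have hpiece : ∀ i ∈ Finset.range n,
      |(n : ℝ)⁻¹ * φ (a i) - ∫ x in a i..a (i + 1), φ x| ≤ (n : ℝ)⁻¹ * ε := fun i hi => by
    have hi0 : 0 ≤ a i := by positivity
    have hi1 : a (i + 1) ≤ 1 := (div_le_one hn0).2 (mod_cast Finset.mem_range.1 hi)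
    rw [← hstep i]
    refine abs_mul_sub_integral_le hφ (hle i) fun x hx => ?_
    refine hε _ ⟨hi0, (hle i).trans hi1⟩ x ⟨hi0.trans hx.1, hx.2.trans hi1⟩ ?_
    rw [abs_sub_comm, abs_of_nonneg (sub_nonneg.2 hx.1), ← hstep i]
    exact sub_le_sub_right hx.2 _
  calc |riemannSum φ n - ∫ x in (0 : ℝ)..1, φ x|
      = |∑ i ∈ Finset.range n, ((n : ℝ)⁻¹ * φ (a i) - ∫ x in a i..a (i + 1), φ x)| := by
        rw [Finset.sum_sub_distrib, hsplit, ← Finset.mul_sum]; rfl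
    _ ≤ ∑ _i ∈ Finset.range n, (n : ℝ)⁻¹ * ε :=
        (Finset.abs_sum_le_sum_abs _ _).trans (Finset.sum_le_sum hpiece)
    _ = ε := by
        rw [Finset.sum_const, Finset.card_range, nsmul_eq_mul, mul_inv_cancel_left₀ hn0.ne']

lemma tendsto_riemannSum {φ : ℝ → ℝ} (hφ : Continuous φ) :
    Tendsto (riemannSum φ) atTop (𝓝 (∫ x in (0 : ℝ)..1, φ x)) := by
  refine Metric.tendsto_atTop'.2 fun ε hε => ?_
  obtain ⟨δ, hδ, hφδ⟩ := Metric.uniformContinuousOn_iff_le.1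
    (isCompact_Icc.uniformContinuousOn_of_continuous hφ.continuousOn) (ε / 2) (half_pos hε)
  obtain ⟨N, hN⟩ := exists_nat_gt δ⁻¹
  refine ⟨N, fun n hn => ?_⟩
  have hmesh : (n : ℝ)⁻¹ ≤ δ :=
    inv_le_of_inv_le₀ hδ (hN.le.trans (Nat.cast_le.2 (le_of_lt hn)))
  exact (abs_riemannSum_sub_integral_le hφ (Nat.zero_lt_of_lt hn) fun x hx y hy hxy =>
    hφδ x hx y hy (hxy.trans hmesh)).trans_lt (half_lt_self hε)

variable {Ω : Type*} [MeasurableSpace Ω] {P : Measure Ω} {X : ℝ → Ω → ℝ}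

lemma aestronglyMeasurable_riemannSum (hX : ∀ s, AEStronglyMeasurable (X s) P) (n : ℕ) :
    AEStronglyMeasurable (fun ω => riemannSum (X · ω) n) P :=
  (Finset.aestronglyMeasurable_fun_sum _ fun _ _ => hX _).const_mul _

lemma aestronglyMeasurable_integral_unitInterval (hX : ∀ s, AEStronglyMeasurable (X s) P)
    (hcont : ∀ᵐ ω ∂P, Continuous (X · ω)) :
    AEStronglyMeasurable (fun ω => ∫ s in (0 : ℝ)..1, X s ω) P :=
  aestronglyMeasurable_of_tendsto_ae atTop (aestronglyMeasurable_riemannSum hX)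
    (hcont.mono fun _ => tendsto_riemannSum)

lemma eLpNorm_riemannSum_le (hX : ∀ s, AEStronglyMeasurable (X s) P) {p A : ENNReal} (hp : 1 ≤ p)
    (hA : ∀ s, eLpNorm (X s) p P ≤ A) (n : ℕ) :
    eLpNorm (fun ω => riemannSum (X · ω) n) p P ≤ A := by
  have hsmul : (fun ω => riemannSum (X · ω) n) =
      (n : ℝ)⁻¹ • ∑ i ∈ Finset.range n, X (i / n) := by
    ext ω; simp [riemannSum]
  calc eLpNorm (fun ω => riemannSum (X · ω) n) p P
      ≤ ‖(n : ℝ)⁻¹‖ₑ * ∑ i ∈ Finset.range n, eLpNorm (X (i / n)) p P := by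
        rw [hsmul, eLpNorm_const_smul]
        gcongr
        exact eLpNorm_sum_le (fun _ _ => hX _) hp
    _ ≤ ‖(n : ℝ)⁻¹‖ₑ * (n * A) := by
        gcongr
        exact (Finset.sum_le_sum fun _ _ => hA _).trans_eq (by simp)
    _ ≤ A := by
        rcases eq_or_ne n 0 with rfl | hn
        · simp
        rw [enorm_inv (Nat.cast_ne_zero.2 hn), Real.enorm_natCast, ← mul_assoc,
          ENNReal.inv_mul_cancel (Nat.cast_ne_zero.2 hn) (ENNReal.natCast_ne_top n), one_mul]

/-- A case of Minkowski's integral inequality, obtained from Fatou's lemma for Riemann sums. -/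
theorem eLpNorm_integral_unitInterval_le (hX : ∀ s, AEStronglyMeasurable (X s) P)
    (hcont : ∀ᵐ ω ∂P, Continuous (X · ω)) {p A : ENNReal} (hp : 1 ≤ p)
    (hA : ∀ s, eLpNorm (X s) p P ≤ A) :
    eLpNorm (fun ω => ∫ s in (0 : ℝ)..1, X s ω) p P ≤ A := by
  refine (Lp.eLpNorm_lim_le_liminf_eLpNorm (aestronglyMeasurable_riemannSum hX) _
    (hcont.mono fun _ => tendsto_riemannSum)).trans ?_
  exact (liminf_le_liminf (.of_forall (eLpNorm_riemannSum_le hX hp hA))).trans_eq (liminf_const A)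

end TimeAverage

section DoubleSum

lemma card_filter_abs_sub_lt_le (N L i : ℕ) :
    ((Finset.range N).filter fun j : ℕ => |(i : ℝ) - j| < L).card ≤ 2 * L := by
  have hsub : ((Finset.range N).filter fun j : ℕ => |(i : ℝ) - j| < L) ⊆
      Finset.Ico (i + 1 - L) (i + L) := fun j hj => by
    obtain ⟨hlow, hupp⟩ := abs_lt.1 (Finset.mem_filter.1 hj).2
    have hj_lt : j < i + L := by rify; linarith
    have hi_lt : i < j + L := by rify; linarith
    exact Finset.mem_Ico.2 ⟨by omega, hj_lt⟩
  refine (Finset.card_le_card hsub).trans ?_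
  rw [Nat.card_Ico]
  omega

variable {C : ℝ → ℝ} {K β c : ℝ}

lemma sum_abs_sub_le (hβ : 0 < β) (hK : 0 ≤ K) (hc : ∀ x, |C x| ≤ c)
    (hC : ∀ x, |C x| ≤ K * (1 + |x|) ^ (-β)) (N i : ℕ) {L : ℕ} (hL : 0 < L) :
    ∑ j ∈ Finset.range N, |C ((i : ℝ) - j)| ≤ 2 * L * c + N * (K * (L : ℝ) ^ (-β)) := by
  have hc0 : 0 ≤ c := (abs_nonneg _).trans (hc 0)
  have hL0 : (0 : ℝ) < L := Nat.cast_pos.2 hL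
  have hnear_or_far (j : ℕ) : |C ((i : ℝ) - j)| ≤
      (if |(i : ℝ) - j| < L then c else 0) + K * (L : ℝ) ^ (-β) := by
    split_ifs with hij
    · exact (hc _).trans (le_add_of_nonneg_right (by positivity))
    · rw [zero_add]
      refine (hC _).trans (mul_le_mul_of_nonneg_left ?_ hK)
      exact Real.rpow_le_rpow_of_nonpos hL0 (by linarith [not_lt.1 hij]) (by linarith)
  calc ∑ j ∈ Finset.range N, |C ((i : ℝ) - j)|
      ≤ ∑ j ∈ Finset.range N, ((if |(i : ℝ) - j| < L then c else 0) + K * (L : ℝ) ^ (-β)) :=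
        Finset.sum_le_sum fun j _ => hnear_or_far j
    _ = ((Finset.range N).filter fun j : ℕ => |(i : ℝ) - j| < L).card * c
        + N * (K * (L : ℝ) ^ (-β)) := by
        rw [Finset.sum_add_distrib, ← Finset.sum_filter, Finset.sum_const, Finset.sum_const,
          Finset.card_range, nsmul_eq_mul, nsmul_eq_mul]
    _ ≤ 2 * L * c + N * (K * (L : ℝ) ^ (-β)) := by
        gcongr
        exact_mod_cast card_filter_abs_sub_lt_le N L i

lemma sum_sum_abs_sub_le (hβ : 0 < β) (hK : 0 ≤ K) (hc : ∀ x, |C x| ≤ c)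
    (hC : ∀ x, |C x| ≤ K * (1 + |x|) ^ (-β)) {q : ℕ} (hq : 4 ≤ q * β) (n : ℕ) :
    ∑ i ∈ Finset.range (n ^ (q + 4)), ∑ j ∈ Finset.range (n ^ (q + 4)), |C ((i : ℝ) - j)| ≤
      (2 * c + K) * ((n : ℝ) + 1) ^ (2 * (q + 2)) := by
  have hc0 : 0 ≤ c := (abs_nonneg _).trans (hc 0)
  set r : ℝ := (n : ℝ) + 1 with hr
  have hr1 : 1 ≤ r := by simp [hr]
  have hfar : (((n + 1) ^ q : ℕ) : ℝ) ^ (-β) ≤ (r ^ 4)⁻¹ := by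
    push_cast
    rw [← Real.rpow_natCast, ← Real.rpow_natCast, ← Real.rpow_mul (by positivity),
      ← Real.rpow_neg (by positivity)]
    exact Real.rpow_le_rpow_of_exponent_le hr1 (by push_cast; linarith)
  have hN : ((n ^ (q + 4) : ℕ) : ℝ) ≤ r ^ (q + 4) := by
    push_cast
    gcongr
    exact (lt_add_one _).le
  calc ∑ i ∈ Finset.range (n ^ (q + 4)), ∑ j ∈ Finset.range (n ^ (q + 4)), |C ((i : ℝ) - j)|
      ≤ (n ^ (q + 4) : ℕ) * (2 * ((n + 1) ^ q : ℕ) * c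
          + (n ^ (q + 4) : ℕ) * (K * (((n + 1) ^ q : ℕ) : ℝ) ^ (-β))) := by
        refine (Finset.sum_le_card_nsmul _ _ _ fun i _ =>
          sum_abs_sub_le hβ hK hc hC _ i (L := (n + 1) ^ q) (by positivity)).trans_eq ?_
        rw [Finset.card_range, nsmul_eq_mul]
    _ ≤ r ^ (q + 4) * (2 * r ^ q * c + r ^ (q + 4) * (K * (r ^ 4)⁻¹)) := by
        gcongr
        push_cast
        rfl
    _ = (2 * c + K) * r ^ (2 * (q + 2)) := by
        field_simp
        ring

end DoubleSum

section MeanWithRate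

/-- The time averages of `φ` over `[0, t]` converge to `m` at the rate `t ^ (-γ)`; the estimate is
written for the integrals, with `1 + t` in place of `t` to cover small times. -/
def HasMeanWithRate (φ : ℝ → ℝ) (m γ : ℝ) : Prop :=
  ∃ M, 0 ≤ M ∧ ∀ t, 0 ≤ t → |∫ y in (0 : ℝ)..t, (φ y - m)| ≤ M * (1 + t) ^ (1 - γ)

lemma integral_natCast_eq_integral_sum {φ : ℝ → ℝ} (hφ : Continuous φ) (N : ℕ) :
    ∫ y in (0 : ℝ)..N, φ y = ∫ s in (0 : ℝ)..1, ∑ i ∈ Finset.range N, φ (i + s) := by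
  have hshift (i : ℕ) : ∫ s in (0 : ℝ)..1, φ (i + s) = ∫ y in (i : ℝ)..(i + 1 : ℕ), φ y := by
    simp
  have hcont (i : ℕ) : Continuous fun s : ℝ => φ (i + s) := by fun_prop
  rw [intervalIntegral.integral_finsetSum fun i _ => (hcont i).intervalIntegrable _ _,
    Finset.sum_congr rfl fun i _ => hshift i,
    intervalIntegral.sum_integral_adjacent_intervals (a := fun i : ℕ => (i : ℝ))
      fun _ _ => hφ.intervalIntegrable _ _, Nat.cast_zero]

lemma abs_sub_mul_le_of_monotone {F : ℝ → ℝ} (hF : Monotone F) {m M : ℝ} (hm : 0 ≤ m)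
    (hM : 0 ≤ M) {k : ℕ}
    (hpow : ∀ n : ℕ, |F (n ^ (k + 1)) - m * n ^ (k + 1)| ≤ M * (n + 1) ^ k) {n : ℕ} {t : ℝ}
    (hnt : (n : ℝ) ^ (k + 1) ≤ t) (htn : t ≤ ((n : ℝ) + 1) ^ (k + 1)) :
    |F t - m * t| ≤ (M * 2 ^ k + m * (k + 1)) * ((n : ℝ) + 1) ^ k := by
  have hgap : ((n : ℝ) + 1) ^ (k + 1) - n ^ (k + 1) ≤ (k + 1) * ((n : ℝ) + 1) ^ k := by
    have h := (le_abs_self _).trans (abs_pow_sub_pow_le ((n : ℝ) + 1) n (k + 1))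
    rwa [add_sub_cancel_left, abs_one, one_mul, Nat.abs_cast, abs_of_nonneg (by positivity),
      max_eq_left (lt_add_one _).le, Nat.cast_add_one, Nat.add_sub_cancel] at h
  have hmgap := mul_le_mul_of_nonneg_left hgap hm
  have hlow := (abs_le.1 (hpow n)).1
  have hupp := (abs_le.1 (hpow (n + 1))).2
  push_cast at hupp
  have hlow_le : M * ((n : ℝ) + 1) ^ k ≤ M * 2 ^ k * ((n : ℝ) + 1) ^ k := by
    gcongr
    exact le_mul_of_one_le_right hM (one_le_pow₀ one_le_two)
  have hupp_le : M * ((n : ℝ) + 1 + 1) ^ k ≤ M * 2 ^ k * ((n : ℝ) + 1) ^ k := by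
    rw [mul_assoc, ← mul_pow]
    gcongr
    linarith [n.cast_nonneg (α := ℝ)]
  have hmt := mul_le_mul_of_nonneg_left hnt hm
  have hmt' := mul_le_mul_of_nonneg_left htn hm
  rw [abs_le]
  constructor <;> linarith [hF hnt, hF htn]

lemma exists_pow_succ_le_le {t : ℝ} (ht : 0 ≤ t) (k : ℕ) :
    ∃ n : ℕ, (n : ℝ) ^ (k + 1) ≤ t ∧ t ≤ ((n : ℝ) + 1) ^ (k + 1) ∧
      ((n : ℝ) + 1) ^ k ≤ 2 ^ k * (1 + t) ^ (1 - ((k : ℝ) + 1)⁻¹) := by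
  set a : ℝ := t ^ ((k + 1 : ℕ) : ℝ)⁻¹ with ha
  have ha0 : 0 ≤ a := by positivity
  have hat : a ^ (k + 1) = t := Real.rpow_inv_natCast_pow ht k.succ_ne_zero
  have hfloor : (⌊a⌋₊ : ℝ) ≤ a := Nat.floor_le ha0
  refine ⟨⌊a⌋₊, ?_, ?_, ?_⟩
  · rw [← hat]; gcongr
  · conv_lhs => rw [← hat]
    gcongr
    exact (Nat.lt_floor_add_one a).le
  · set b : ℝ := (1 + t) ^ ((k : ℝ) + 1)⁻¹ with hb
    have hab : a ≤ b := by
      rw [ha, Nat.cast_add_one]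
      exact Real.rpow_le_rpow ht (by linarith) (by positivity)
    have hb1 : 1 ≤ b := Real.one_le_rpow (by linarith) (by positivity)
    calc ((⌊a⌋₊ : ℝ) + 1) ^ k ≤ (2 * b) ^ k := by gcongr; linarith
      _ = 2 ^ k * (1 + t) ^ (1 - ((k : ℝ) + 1)⁻¹) := by
        rw [mul_pow, hb, ← Real.rpow_mul_natCast (by linarith)]
        congr 2
        field_simp
        ring

lemma hasMeanWithRate_of_pow {φ : ℝ → ℝ} (hφ : Continuous φ) (hφ0 : ∀ y, 0 ≤ φ y) {m M : ℝ}
    (hm : 0 ≤ m) (hM : 0 ≤ M) {k : ℕ}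
    (hpow : ∀ n : ℕ, |∫ y in (0 : ℝ)..(n ^ (k + 1) : ℕ), (φ y - m)| ≤ M * (n + 1) ^ k) :
    HasMeanWithRate φ m ((k : ℝ) + 1)⁻¹ := by
  let F : ℝ → ℝ := fun t => ∫ y in (0 : ℝ)..t, φ y
  have hF : Monotone F := fun a b hab => by
    rw [← sub_nonneg, intervalIntegral.integral_interval_sub_left (hφ.intervalIntegrable _ _)
      (hφ.intervalIntegrable _ _)]
    exact intervalIntegral.integral_nonneg hab fun y _ => hφ0 y
  have hcentred (t : ℝ) : ∫ y in (0 : ℝ)..t, (φ y - m) = F t - m * t := by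
    rw [intervalIntegral.integral_sub (hφ.intervalIntegrable _ _) intervalIntegrable_const,
      intervalIntegral.integral_const, smul_eq_mul, sub_zero, mul_comm]
  refine ⟨(M * 2 ^ k + m * (k + 1)) * 2 ^ k, by positivity, fun t ht => ?_⟩
  obtain ⟨n, hnt, htn, hn⟩ := exists_pow_succ_le_le ht k
  rw [hcentred, mul_assoc]
  refine (abs_sub_mul_le_of_monotone hF hm hM (fun n => ?_) hnt htn).trans (by gcongr)
  simpa [hcentred] using hpow n

end MeanWithRate

section LawOfLargeNumbers

variable {Ω : Type*} [MeasurableSpace Ω] {P : Measure Ω} {G : ℝ → Ω → ℝ} {C : ℝ → ℝ} {β : ℝ}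

lemma eLpNorm_two_sub_integral [IsFiniteMeasure P] {X : Ω → ℝ} (hX : MemLp X 2 P) :
    eLpNorm (fun ω => X ω - ∫ ω, X ω ∂P) 2 P = ENNReal.ofReal √Var[X; P] := by
  refine (ENNReal.pow_right_strictMono two_ne_zero).injective ?_
  have h := eLpNorm_nnreal_pow_eq_lintegral (μ := P) (f := fun ω => X ω - ∫ ω, X ω ∂P)
    (p := 2) two_ne_zero
  simp only [NNReal.coe_ofNat, ENNReal.coe_ofNat, ENNReal.rpow_ofNat] at h
  rw [h, ← ENNReal.ofReal_pow (Real.sqrt_nonneg _), Real.sq_sqrt (variance_nonneg _ _),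
    ofReal_variance hX, evariance]

namespace IsStationaryGaussianField

lemma eLpNorm_sum_exp_sub_le (hG : IsStationaryGaussianField G C P) (N : ℕ) (s : ℝ) :
    eLpNorm (fun ω => ∑ i ∈ Finset.range N, (Real.exp (G (i + s) ω) - Real.exp (C 0 / 2))) 2 P ≤
      ENNReal.ofReal √(Real.exp (2 * C 0) *
        ∑ i ∈ Finset.range N, ∑ j ∈ Finset.range N, |C ((i : ℝ) - j)|) := by
  have := hG.isProbabilityMeasure
  let E : ℕ → Ω → ℝ := fun i ω => Real.exp (G (i + s) ω)
  have hE (i : ℕ) : MemLp (E i) 2 P := hG.memLp_two_exp (i + s)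
  have hmean : ∫ ω, ∑ i ∈ Finset.range N, E i ω ∂P = ∑ i ∈ Finset.range N, Real.exp (C 0 / 2) := by
    rw [integral_finsetSum _ fun i _ => (hE i).integrable one_le_two]
    exact Finset.sum_congr rfl fun i _ => hG.integral_exp _
  have hvar : Var[fun ω => ∑ i ∈ Finset.range N, E i ω; P] ≤ Real.exp (2 * C 0) *
      ∑ i ∈ Finset.range N, ∑ j ∈ Finset.range N, |C ((i : ℝ) - j)| := by
    rw [variance_fun_sum' fun i _ => hE i, Finset.mul_sum]
    refine Finset.sum_le_sum fun i _ => ?_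
    rw [Finset.mul_sum]
    refine Finset.sum_le_sum fun j _ => ?_
    simpa only [add_sub_add_right_eq_sub] using hG.covariance_exp_le (i + s) (j + s)
  have hnorm := eLpNorm_two_sub_integral (memLp_finsetSum (Finset.range N) fun i _ => hE i)
  simp only [hmean, ← Finset.sum_sub_distrib] at hnorm
  rw [hnorm]
  gcongr

lemma eLpNorm_integral_exp_sub_le (hG : IsStationaryGaussianField G C P)
    (hcont : ∀ᵐ ω ∂P, Continuous (G · ω)) (N : ℕ) :
    AEStronglyMeasurable
      (fun ω => ∫ y in (0 : ℝ)..N, (Real.exp (G y ω) - Real.exp (C 0 / 2))) P ∧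
    eLpNorm (fun ω => ∫ y in (0 : ℝ)..N, (Real.exp (G y ω) - Real.exp (C 0 / 2))) 2 P ≤
      ENNReal.ofReal √(Real.exp (2 * C 0) *
        ∑ i ∈ Finset.range N, ∑ j ∈ Finset.range N, |C ((i : ℝ) - j)|) := by
  let X : ℝ → Ω → ℝ := fun s ω =>
    ∑ i ∈ Finset.range N, (Real.exp (G (i + s) ω) - Real.exp (C 0 / 2))
  have hX (s : ℝ) : AEStronglyMeasurable (X s) P :=
    Finset.aestronglyMeasurable_fun_sum _ fun i _ =>
      (hG.memLp_two_exp _).1.sub aestronglyMeasurable_const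
  have hXcont : ∀ᵐ ω ∂P, Continuous (X · ω) := by
    filter_upwards [hcont] with ω hω
    fun_prop
  have hint : (fun ω => ∫ s in (0 : ℝ)..1, X s ω) =ᵐ[P]
      fun ω => ∫ y in (0 : ℝ)..N, (Real.exp (G y ω) - Real.exp (C 0 / 2)) := by
    filter_upwards [hcont] with ω hω
    exact (integral_natCast_eq_integral_sum
      (φ := fun y => Real.exp (G y ω) - Real.exp (C 0 / 2)) (by fun_prop) N).symm
  exact ⟨(aestronglyMeasurable_integral_unitInterval hX hXcont).congr hint,
    (eLpNorm_congr_ae hint).symm.trans_le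
      (eLpNorm_integral_unitInterval_le hX hXcont one_le_two (hG.eLpNorm_sum_exp_sub_le N))⟩

lemma ae_exists_abs_integral_exp_sub_le (hG : IsStationaryGaussianField G C P)
    (hcont : ∀ᵐ ω ∂P, Continuous (G · ω)) (hβ : 0 < β) (hdecay : DecaysWithRate C β) {q : ℕ}
    (hq : 4 ≤ q * β) :
    ∀ᵐ ω ∂P, ∃ M, 0 ≤ M ∧ ∀ n : ℕ,
      |∫ y in (0 : ℝ)..(n ^ (q + 4) : ℕ), (Real.exp (G y ω) - Real.exp (C 0 / 2))| ≤
        M * (n + 1) ^ (q + 3) := by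
  obtain ⟨K, hK⟩ := hdecay
  have hK0 : 0 ≤ K := by simpa using (abs_nonneg _).trans (hK 0)
  set D : ℝ := Real.exp (2 * C 0) * (2 * C 0 + K) with hD
  have hnorm (n : ℕ) : eLpNorm (fun ω => ∫ y in (0 : ℝ)..(n ^ (q + 4) : ℕ),
      (Real.exp (G y ω) - Real.exp (C 0 / 2))) (2 : ℕ) P ≤
        ENNReal.ofReal (√D * ((n : ℝ) + 1) ^ (q + 2)) := by
    refine (hG.eLpNorm_integral_exp_sub_le hcont _).2.trans (ENNReal.ofReal_le_ofReal ?_)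
    rw [← Real.sqrt_sq (by positivity : (0 : ℝ) ≤ ((n : ℝ) + 1) ^ (q + 2)),
      ← Real.sqrt_mul' _ (by positivity), ← pow_mul, mul_comm (q + 2), hD, mul_assoc]
    gcongr
    exact sum_sum_abs_sub_le hβ hK0 hG.abs_covariance_le hK hq n
  have hsum : Summable fun n : ℕ =>
      (√D * ((n : ℝ) + 1) ^ (q + 2) / ((n : ℝ) + 1) ^ (q + 3)) ^ 2 := by
    refine (((summable_nat_add_iff 1).2 (Real.summable_nat_pow_inv.2 one_lt_two)).mul_left
      (√D ^ 2)).congr fun n => ?_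
    rw [pow_succ _ (q + 2)]
    push_cast
    field_simp
  exact ae_exists_norm_le_mul_of_summable_pow two_ne_zero
    (fun n => (hG.eLpNorm_integral_exp_sub_le hcont _).1) (fun n => by positivity)
    (fun n => by positivity) hnorm hsum

/-- The moment bound is too weak to be summed over all integer times; it is summed over the times
`n ^ (q + 4)`, between which the integral of `exp G` is monotone. -/
theorem ae_hasMeanWithRate_exp (hG : IsStationaryGaussianField G C P)
    (hcont : ∀ᵐ ω ∂P, Continuous (G · ω)) (hβ : 0 < β) (hdecay : DecaysWithRate C β) :
    ∃ γ, 0 < γ ∧ γ ≤ 1 ∧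
      ∀ᵐ ω ∂P, HasMeanWithRate (fun y => Real.exp (G y ω)) (Real.exp (C 0 / 2)) γ := by
  obtain ⟨q, hq⟩ := exists_nat_ge (4 / β)
  rw [div_le_iff₀ hβ] at hq
  refine ⟨(((q + 3 : ℕ) : ℝ) + 1)⁻¹, by positivity, inv_le_one_of_one_le₀ ?_, ?_⟩
  · exact le_add_of_nonneg_left (Nat.cast_nonneg _)
  filter_upwards [hcont, hG.ae_exists_abs_integral_exp_sub_le hcont hβ hdecay hq]
    with ω hω ⟨M, hM, hpow⟩
  exact hasMeanWithRate_of_pow (by fun_prop) (fun _ => (Real.exp_pos _).le) (Real.exp_pos _).le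
    hM hpow

end IsStationaryGaussianField

end LawOfLargeNumbers

section Dirichlet

variable {A f u : ℝ → ℝ} {a b x : ℝ}

lemma hasDerivAt_derivWithin_Icc (hu : ContDiffOn ℝ 1 u (Icc a b)) (hx : x ∈ Ioo a b) :
    HasDerivAt u (derivWithin u (Icc a b) x) x :=
  ((hu.differentiableOn one_ne_zero) x (Ioo_subset_Icc_self hx)).hasDerivWithinAt.hasDerivAt
    (Icc_mem_nhds hx.1 hx.2)

lemma exists_contDiffOn_eqOn_derivWithin {w : ℝ → ℝ} (hab : a < b)
    (hw : ContinuousOn w (Icc a b)) :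
    ∃ u, ContDiffOn ℝ 1 u (Icc a b) ∧ u a = 0 ∧
      EqOn (derivWithin u (Icc a b)) w (Icc a b) := by
  set W : ℝ → ℝ := IccExtend hab.le ((Icc a b).domRestrict w)
  have hW : Continuous W := hw.domRestrict.Icc_extend'
  have hderiv : ∀ x, HasDerivAt (fun x => ∫ y in a..x, W y) (W x) x := fun x =>
    (hW.integral_hasStrictDerivAt a x).hasDerivAt
  refine ⟨fun x => ∫ y in a..x, W y, ?_, intervalIntegral.integral_same, fun x hx => ?_⟩
  · refine (contDiff_one_iff_deriv.2 ⟨fun x => (hderiv x).differentiableAt, ?_⟩).contDiffOn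
    rwa [funext fun x => (hderiv x).deriv]
  · rw [(hderiv x).hasDerivWithinAt.derivWithin (uniqueDiffOn_Icc hab x hx)]
    exact IccExtend_of_mem hab.le _ hx

/-- The constant `c` for which a solution of `(A u')' = f'`, `u 0 = u 1 = 0`, satisfies
`A u' = f + c`; it is determined by `∫₀¹ u' = 0`. -/
noncomputable def fluxConstant (A f : ℝ → ℝ) : ℝ :=
  -(∫ x in (0 : ℝ)..1, f x * (A x)⁻¹) / ∫ x in (0 : ℝ)..1, (A x)⁻¹

lemma fluxConstant_const (ha : a ≠ 0) (f : ℝ → ℝ) :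
    fluxConstant (fun _ => a) f = -∫ x in (0 : ℝ)..1, f x := by
  simp only [fluxConstant, intervalIntegral.integral_mul_const, intervalIntegral.integral_const,
    sub_zero, one_smul, neg_div, mul_div_cancel_right₀ _ (inv_ne_zero ha)]

lemma integral_add_mul_inv_eq_zero_iff (hA : ContinuousOn A (Icc 0 1))
    (hpos : ∀ x ∈ Icc (0 : ℝ) 1, 0 < A x) (hf : ContinuousOn f (Icc 0 1)) {c : ℝ} :
    ∫ x in (0 : ℝ)..1, (f x + c) * (A x)⁻¹ = 0 ↔ c = fluxConstant A f := by
  have hAinv : ContinuousOn (fun x => (A x)⁻¹) (Icc 0 1) := hA.inv₀ fun x hx => (hpos x hx).ne'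
  have hAint : IntervalIntegrable (fun x => (A x)⁻¹) volume 0 1 :=
    hAinv.intervalIntegrable_of_Icc zero_le_one
  have hIpos : 0 < ∫ x in (0 : ℝ)..1, (A x)⁻¹ :=
    intervalIntegral.intervalIntegral_pos_of_pos_on hAint
      (fun x hx => inv_pos.2 (hpos x (Ioo_subset_Icc_self hx))) zero_lt_one
  have hfAint : IntervalIntegrable (fun x => f x * (A x)⁻¹) volume 0 1 :=
    (hf.mul hAinv).intervalIntegrable_of_Icc zero_le_one
  simp_rw [add_mul]
  rw [intervalIntegral.integral_add hfAint (hAint.const_mul c),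
    intervalIntegral.integral_const_mul, fluxConstant, eq_div_iff hIpos.ne', add_comm,
    add_eq_zero_iff_eq_neg]

lemma IsSolution.exists_mul_derivWithin_eq_add (hA : ContinuousOn A (Icc 0 1))
    (hf : ContDiffOn ℝ 1 f (Icc 0 1)) (hu : IsSolution A f u) :
    ∃ c, ∀ x ∈ Icc (0 : ℝ) 1, A x * derivWithin u (Icc 0 1) x = f x + c := by
  set g : ℝ → ℝ := fun y => A y * derivWithin u (Icc 0 1) y - f y
  have hg : ContinuousOn g (Icc 0 1) :=
    (hA.mul (hu.contDiffOn.continuousOn_derivWithin (uniqueDiffOn_Icc zero_lt_one) le_rfl)).sub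
      hf.continuousOn
  have hg' : ∀ y ∈ Ioo (0 : ℝ) 1, HasDerivAt g 0 y := fun y hy => by
    rw [← sub_self (deriv f y)]
    exact (hu.equation y hy).sub (hasDerivAt_derivWithin_Icc hf hy).differentiableAt.hasDerivAt
  refine ⟨g 0, fun x hx => ?_⟩
  have hconst := intervalIntegral.integral_eq_sub_of_hasDerivAt_of_le hx.1
    (hg.mono (Icc_subset_Icc_right hx.2)) (fun y hy => hg' y ⟨hy.1, hy.2.trans_le hx.2⟩)
    intervalIntegrable_const
  rw [intervalIntegral.integral_zero, eq_comm, sub_eq_zero] at hconst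
  rw [← hconst]
  exact (add_sub_cancel _ _).symm

lemma IsSolution.derivWithin_eq (hA : ContinuousOn A (Icc 0 1))
    (hpos : ∀ x ∈ Icc (0 : ℝ) 1, 0 < A x) (hf : ContDiffOn ℝ 1 f (Icc 0 1))
    (hu : IsSolution A f u) (hx : x ∈ Icc (0 : ℝ) 1) :
    derivWithin u (Icc 0 1) x = (f x + fluxConstant A f) * (A x)⁻¹ := by
  obtain ⟨c, hc⟩ := hu.exists_mul_derivWithin_eq_add hA hf
  have hu' : ∀ y ∈ Icc (0 : ℝ) 1, derivWithin u (Icc 0 1) y = (f y + c) * (A y)⁻¹ := fun y hy => by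
    rw [← hc y hy, mul_comm (A y), mul_inv_cancel_right₀ (hpos y hy).ne']
  have hzero : ∫ y in (0 : ℝ)..1, (f y + c) * (A y)⁻¹ = 0 := by
    rw [intervalIntegral.integral_congr fun y hy => (hu' y (uIcc_of_le (zero_le_one' ℝ) ▸ hy)).symm,
      intervalIntegral.integral_derivWithin_Icc_of_contDiffOn_Icc hu.contDiffOn zero_le_one,
      hu.left, hu.right, sub_zero]
  rw [hu' x hx, (integral_add_mul_inv_eq_zero_iff hA hpos hf.continuousOn).1 hzero]

lemma isSolution_of_derivWithin_eq (hA : ContinuousOn A (Icc 0 1))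
    (hpos : ∀ x ∈ Icc (0 : ℝ) 1, 0 < A x) (hf : ContDiffOn ℝ 1 f (Icc 0 1))
    (hu : ContDiffOn ℝ 1 u (Icc 0 1)) (hu0 : u 0 = 0)
    (hu' : ∀ x ∈ Icc (0 : ℝ) 1, derivWithin u (Icc 0 1) x = (f x + fluxConstant A f) * (A x)⁻¹) :
    IsSolution A f u where
  contDiffOn := hu
  equation x hx := by
    have hderiv : HasDerivAt (fun y => f y + fluxConstant A f) (deriv f x) x :=
      (hasDerivAt_derivWithin_Icc hf hx).differentiableAt.hasDerivAt.add_const _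
    refine hderiv.congr_of_eventuallyEq ?_
    filter_upwards [Icc_mem_nhds hx.1 hx.2] with y hy
    rw [hu' y hy, mul_comm (A y), inv_mul_cancel_right₀ (hpos y hy).ne']
  left := hu0
  right := by
    rw [← sub_zero (u 1), ← hu0,
      ← intervalIntegral.integral_derivWithin_Icc_of_contDiffOn_Icc hu zero_le_one,
      intervalIntegral.integral_congr fun y hy => hu' y (uIcc_of_le (zero_le_one' ℝ) ▸ hy)]
    exact ((integral_add_mul_inv_eq_zero_iff hA hpos hf.continuousOn).2 rfl).trans hu0.symm

theorem wellPosed_of_continuousOn_of_pos (hA : ContinuousOn A (Icc 0 1))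
    (hpos : ∀ x ∈ Icc (0 : ℝ) 1, 0 < A x) (hf : ContDiffOn ℝ 1 f (Icc 0 1)) : WellPosed A f := by
  have hw : ContinuousOn (fun x => (f x + fluxConstant A f) * (A x)⁻¹) (Icc 0 1) :=
    (hf.continuousOn.add continuousOn_const).mul (hA.inv₀ fun x hx => (hpos x hx).ne')
  obtain ⟨u, hu, hu0, hu'⟩ := exists_contDiffOn_eqOn_derivWithin zero_lt_one hw
  have hsol : IsSolution A f u := isSolution_of_derivWithin_eq hA hpos hf hu hu0 hu'
  refine ⟨u, hsol, fun v hv => eq_of_derivWithin_eq (hv.contDiffOn.differentiableOn one_ne_zero)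
    (hu.differentiableOn one_ne_zero) (fun x hx => ?_) (hv.left.trans hu0.symm)⟩
  rw [hv.derivWithin_eq hA hpos hf (Ico_subset_Icc_self hx), hu' (Ico_subset_Icc_self hx)]

end Dirichlet

section Homogenization

open Asymptotics

variable {A φ f : ℝ → ℝ} {a m γ s : ℝ}

lemma exists_abs_integral_mul_le (hf : ContDiffOn ℝ 1 f (Icc 0 1)) :
    ∃ L, ∀ (φ : ℝ → ℝ) (b : ℝ), Continuous φ →
      (∀ x ∈ Icc (0 : ℝ) 1, |∫ y in (0 : ℝ)..x, φ y| ≤ b) →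
      |∫ x in (0 : ℝ)..1, f x * φ x| ≤ L * b := by
  have hf' : ContinuousOn (derivWithin f (Icc 0 1)) (Icc 0 1) :=
    hf.continuousOn_derivWithin (uniqueDiffOn_Icc zero_lt_one) le_rfl
  obtain ⟨D, hD⟩ := isCompact_Icc.exists_bound_of_continuousOn hf'
  refine ⟨|f 1| + D, fun φ b hφ hb => ?_⟩
  set Φ : ℝ → ℝ := fun x => ∫ y in (0 : ℝ)..x, φ y
  have hΦ (x : ℝ) : HasDerivAt Φ (φ x) x := (hφ.integral_hasStrictDerivAt 0 x).hasDerivAt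
  have hparts : ∫ x in (0 : ℝ)..1, f x * φ x =
      f 1 * Φ 1 - f 0 * Φ 0 - ∫ x in (0 : ℝ)..1, derivWithin f (Icc 0 1) x * Φ x := by
    refine intervalIntegral.integral_mul_deriv_eq_deriv_mul_of_hasDerivAt ?_
      (fun x _ => (hΦ x).continuousAt.continuousWithinAt)
      (fun x hx => hasDerivAt_derivWithin_Icc hf (by simpa using hx)) (fun x _ => hΦ x)
      (hf'.intervalIntegrable_of_Icc zero_le_one) (hφ.intervalIntegrable _ _)
    rw [uIcc_of_le zero_le_one]
    exact hf.continuousOn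
  have hbdry : |f 1 * Φ 1| ≤ |f 1| * b := by
    rw [abs_mul]
    exact mul_le_mul_of_nonneg_left (hb 1 (right_mem_Icc.2 zero_le_one)) (abs_nonneg _)
  have hbulk : ‖∫ x in (0 : ℝ)..1, derivWithin f (Icc 0 1) x * Φ x‖ ≤ D * b * |(1 : ℝ) - 0| := by
    refine intervalIntegral.norm_integral_le_of_norm_le_const fun x hx => ?_
    rw [uIoc_of_le zero_le_one] at hx
    have hx' : x ∈ Icc (0 : ℝ) 1 := Ioc_subset_Icc_self hx
    rw [norm_mul]
    exact mul_le_mul (hD x hx') (hb x hx') (norm_nonneg _) ((norm_nonneg _).trans (hD x hx'))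
  rw [Real.norm_eq_abs, sub_zero, abs_one, mul_one] at hbulk
  rw [hparts, show Φ 0 = 0 from intervalIntegral.integral_same, mul_zero, sub_zero, add_mul]
  exact (abs_sub _ _).trans (add_le_add hbdry hbulk)

lemma HasMeanWithRate.exists_abs_integral_comp_div_sub_le (hφ : HasMeanWithRate φ m γ)
    (hγ : γ ≤ 1) :
    ∃ M, ∀ ε ∈ Ioc (0 : ℝ) 1, ∀ x ∈ Icc (0 : ℝ) 1,
      |∫ y in (0 : ℝ)..x, (φ (y / ε) - m)| ≤ M * ε ^ γ := by
  obtain ⟨M, hM, hbound⟩ := hφ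
  refine ⟨M * 2 ^ (1 - γ), fun ε hε x hx => ?_⟩
  have hxε : 0 ≤ x / ε := div_nonneg hx.1 hε.1.le
  have htime : 1 + x / ε ≤ 2 / ε := by
    rw [le_div_iff₀ hε.1, add_mul, div_mul_cancel₀ _ hε.1.ne']
    linarith [hx.2, hε.2]
  rw [intervalIntegral.integral_comp_div (fun y => φ y - m) hε.1.ne', zero_div, smul_eq_mul,
    abs_mul, abs_of_pos hε.1]
  calc ε * |∫ y in (0 : ℝ)..x / ε, (φ y - m)|
      ≤ ε * (M * (1 + x / ε) ^ (1 - γ)) := mul_le_mul_of_nonneg_left (hbound _ hxε) hε.1.le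
    _ ≤ ε * (M * (2 / ε) ^ (1 - γ)) := by
        have : 0 ≤ 1 - γ := sub_nonneg.2 hγ
        have := hε.1
        gcongr
    _ = M * 2 ^ (1 - γ) * ε ^ γ := by
        rw [Real.div_rpow zero_le_two hε.1.le, Real.rpow_sub hε.1, Real.rpow_one]
        have := hε.1.ne'
        field_simp

lemma HasMeanWithRate.isBigO_integral_mul_comp_div_sub (hmean : HasMeanWithRate φ m γ)
    (hφ : Continuous φ) (hγ : γ ≤ 1) (hf : ContDiffOn ℝ 1 f (Icc 0 1)) :
    (fun ε => (∫ x in (0 : ℝ)..1, f x * φ (x / ε)) - (∫ x in (0 : ℝ)..1, f x) * m)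
      =O[𝓝[>] 0] fun ε => ε ^ γ := by
  obtain ⟨L, hL⟩ := exists_abs_integral_mul_le hf
  obtain ⟨M, hM⟩ := hmean.exists_abs_integral_comp_div_sub_le hγ
  refine IsBigO.of_bound (L * M) ?_
  filter_upwards [Ioc_mem_nhdsGT zero_lt_one] with ε hε
  have hφε : Continuous fun x => φ (x / ε) := by fun_prop
  have hfint : IntervalIntegrable f volume 0 1 :=
    hf.continuousOn.intervalIntegrable_of_Icc zero_le_one
  rw [← intervalIntegral.integral_mul_const, ← intervalIntegral.integral_sub
    (hfint.mul_continuousOn hφε.continuousOn) (hfint.mul_const m), Real.norm_eq_abs,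
    Real.norm_of_nonneg (Real.rpow_nonneg hε.1.le γ), mul_assoc]
  simp_rw [← mul_sub]
  exact hL _ _ (hφε.sub continuous_const) (hM ε hε)

lemma tendsto_rpow_nhdsGT_zero (hs : 0 < s) :
    Tendsto (fun ε : ℝ => ε ^ s) (𝓝[>] 0) (𝓝 0) := by
  have h := (Real.continuousAt_rpow_const 0 s (Or.inr hs.le)).tendsto
  rw [Real.zero_rpow hs.ne'] at h
  exact h.mono_left nhdsWithin_le_nhds

theorem isBigO_fluxConstant_comp_div_sub (hf : ContDiffOn ℝ 1 f (Icc 0 1))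
    (hA : Continuous fun x => (A x)⁻¹) (ha : a ≠ 0)
    (hmean : HasMeanWithRate (fun x => (A x)⁻¹) a⁻¹ γ) (hγ : 0 < γ) (hγ1 : γ ≤ 1) :
    (fun ε => fluxConstant (fun x => A (x / ε)) f - fluxConstant (fun _ => a) f)
      =O[𝓝[>] 0] fun ε => ε ^ γ := by
  set I : ℝ → ℝ := fun ε => ∫ x in (0 : ℝ)..1, (A (x / ε))⁻¹
  set J : ℝ → ℝ := fun ε => ∫ x in (0 : ℝ)..1, f x * (A (x / ε))⁻¹
  set F : ℝ := ∫ x in (0 : ℝ)..1, f x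
  have hJ : (fun ε => J ε - F * a⁻¹) =O[𝓝[>] 0] fun ε => ε ^ γ :=
    hmean.isBigO_integral_mul_comp_div_sub hA hγ1 hf
  have hI : (fun ε => I ε - a⁻¹) =O[𝓝[>] 0] fun ε => ε ^ γ := by
    simpa using hmean.isBigO_integral_mul_comp_div_sub hA hγ1 (contDiffOn_const (c := (1 : ℝ)))
  have hlim : Tendsto I (𝓝[>] 0) (𝓝 a⁻¹) :=
    tendsto_sub_nhds_zero_iff.1 (hI.trans_tendsto (tendsto_rpow_nhdsGT_zero hγ))
  have hIinv : (fun ε => (I ε)⁻¹) =O[𝓝[>] 0] fun _ => (1 : ℝ) :=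
    (hlim.inv₀ (inv_ne_zero ha)).isBigO_one ℝ
  have hprod := ((hI.const_mul_left F).sub hJ).mul hIinv
  simp only [mul_one] at hprod
  refine hprod.congr' ?_ .rfl
  filter_upwards [hlim.eventually_ne (inv_ne_zero ha)] with ε hε
  rw [fluxConstant_const ha, fluxConstant]
  change (F * (I ε - a⁻¹) - (J ε - F * a⁻¹)) * (I ε)⁻¹ = -J ε / I ε - -F
  field_simp
  ring

lemma isBigO_comp_div_of_le_mul_rpow {M : ℝ} (hφ0 : ∀ x, 0 ≤ φ x)
    (hφ : ∀ x, φ x ≤ M * (2 + |x|) ^ s) (hs : 0 ≤ s) (x : ℝ) :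
    (fun ε => φ (x / ε)) =O[𝓝[>] 0] fun ε => ε ^ (-s) := by
  have hM : 0 ≤ M := nonneg_of_mul_nonneg_left ((hφ0 0).trans (hφ 0)) (by positivity)
  refine IsBigO.of_bound (M * (2 + |x|) ^ s) ?_
  filter_upwards [Ioc_mem_nhdsGT zero_lt_one] with ε hε
  have hε0 : 0 < ε := hε.1
  have hscale : 2 + |x / ε| ≤ (2 + |x|) / ε := by
    rw [abs_div, abs_of_pos hε0, add_div]
    gcongr
    exact le_div_self zero_le_two hε0 hε.2
  rw [Real.norm_of_nonneg (hφ0 _), Real.norm_of_nonneg (Real.rpow_nonneg hε0.le _)]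
  calc φ (x / ε) ≤ M * (2 + |x / ε|) ^ s := hφ _
    _ ≤ M * ((2 + |x|) / ε) ^ s := by gcongr
    _ = M * (2 + |x|) ^ s * ε ^ (-s) := by
        rw [Real.div_rpow (by positivity) hε0.le, Real.rpow_neg hε0.le, ← div_eq_mul_inv,
          mul_div_assoc]

theorem tendsto_derivWithin_sub_mul_div (hf : ContDiffOn ℝ 1 f (Icc 0 1)) (hA : Continuous A)
    (hpos : ∀ x, 0 < A x) (ha : 0 < a) (hγ : 0 < γ) (hγ1 : γ ≤ 1)
    (hmean : HasMeanWithRate (fun x => (A x)⁻¹) a⁻¹ γ)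
    (hgrowth : ∃ M, ∀ x, (A x)⁻¹ ≤ M * (2 + |x|) ^ (γ / 2))
    {u : ℝ → ℝ → ℝ} (hu : ∀ ε, 0 < ε → IsSolution (fun x => A (x / ε)) f (u ε))
    {ubar : ℝ → ℝ} (hubar : IsSolution (fun _ => a) f ubar) {x : ℝ} (hx : x ∈ Icc (0 : ℝ) 1) :
    Tendsto (fun ε => derivWithin (u ε) (Icc 0 1) x -
      derivWithin ubar (Icc 0 1) x * (a / A (x / ε))) (𝓝[>] 0) (𝓝 0) := by
  obtain ⟨M, hM⟩ := hgrowth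
  have hflux := isBigO_fluxConstant_comp_div_sub hf (hA.inv₀ fun x => (hpos x).ne') ha.ne' hmean
    hγ hγ1
  have hcoef := isBigO_comp_div_of_le_mul_rpow (fun x => (inv_pos.2 (hpos x)).le) hM
    (half_pos hγ).le x
  have hlim : Tendsto (fun ε : ℝ => ε ^ γ * ε ^ (-(γ / 2))) (𝓝[>] 0) (𝓝 0) := by
    refine (tendsto_rpow_nhdsGT_zero (half_pos hγ)).congr' ?_
    filter_upwards [self_mem_nhdsWithin] with ε hε
    rw [← Real.rpow_add hε, add_neg_eq_iff_eq_add.2 (add_halves γ).symm]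
  refine ((hflux.mul hcoef).trans_tendsto hlim).congr' ?_
  filter_upwards [self_mem_nhdsWithin] with ε (hε : 0 < ε)
  rw [(hu ε hε).derivWithin_eq (by fun_prop) (fun y _ => hpos _) hf hx,
    hubar.derivWithin_eq continuousOn_const (fun _ _ => ha) hf hx]
  field_simp
  ring

end Homogenization

section RandomCoefficient

variable {Ω : Type*} [MeasurableSpace Ω] {P : Measure Ω} {G : ℝ → Ω → ℝ} {C : ℝ → ℝ} {s : ℝ}

namespace IsStationaryGaussianField

theorem exists_isContinuousModification [IsProbabilityMeasure P]
    (hG : IsStationaryGaussianField G C P) (hC : HolderAtZero C) :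
    ∃ H, IsContinuousModification H G P := by
  obtain ⟨η, hη, hGη⟩ := hG.isLpHolder hC
  exact hGη.exists_isContinuousModification hη

theorem ae_exists_exp_le_mul_rpow [IsProbabilityMeasure P]
    (hG : IsStationaryGaussianField G C P) (hC : HolderAtZero C)
    (hcont : ∀ᵐ ω ∂P, Continuous (G · ω)) (hs : 0 < s) :
    ∀ᵐ ω ∂P, ∃ M, ∀ x, Real.exp (G x ω) ≤ M * (2 + |x|) ^ s := by
  obtain ⟨η, hη, hGη⟩ := hG.isLpHolder hC
  have hexpcont : ∀ᵐ ω ∂P, Continuous fun x => Real.exp (G x ω) :=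
    hcont.mono fun ω hω => Real.continuous_exp.comp hω
  simpa only [Real.abs_exp] using (hGη.exp hG.hasBoundedMoments_exp).ae_exists_abs_le_mul_rpow hη
    hG.hasBoundedMoments_exp hexpcont hs

end IsStationaryGaussianField

end RandomCoefficient

theorem theorem0 {Ω : Type*} [MeasurableSpace Ω] (P : Measure Ω) [IsProbabilityMeasure P]
    (G : ℝ → Ω → ℝ) (C : ℝ → ℝ) (β : ℝ) (hβ : 0 < β)
    (hG : IsStationaryGaussianField G C P)
    (hHolder : HolderAtZero C) (hdecay : DecaysWithRate C β)
    (f : ℝ → ℝ) (hf : ContDiffOn ℝ 1 f (Icc 0 1)) :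
    -- the field has a continuous modification
    (∃ H : ℝ → Ω → ℝ, IsContinuousModification H G P) ∧
    -- the effective problem is well-posed
    WellPosed (fun _ => Real.exp (-(C 0 / 2))) f ∧
    ∀ H : ℝ → Ω → ℝ, IsContinuousModification H G P →
      ∀ᵐ ω ∂P,
        (∀ ε : ℝ, 0 < ε → WellPosed (fun x => Real.exp (H (x / ε) ω)) f) ∧
        ∀ (u : ℝ → ℝ → ℝ) (ubar : ℝ → ℝ),
          (∀ ε : ℝ, 0 < ε → IsSolution (fun x => Real.exp (H (x / ε) ω)) f (u ε)) →
          IsSolution (fun _ => Real.exp (-(C 0 / 2))) f ubar →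
          ∀ x ∈ Icc (0 : ℝ) 1,
            Tendsto
              (fun ε : ℝ => derivWithin (u ε) (Icc 0 1) x -
                derivWithin ubar (Icc 0 1) x *
                  (Real.exp (-(C 0 / 2)) / Real.exp (H (x / ε) ω)))
              (𝓝[>] 0) (𝓝 0) := by
  refine ⟨hG.exists_isContinuousModification hHolder,
    wellPosed_of_continuousOn_of_pos continuousOn_const (fun _ _ => Real.exp_pos _) hf,
    fun H hH => ?_⟩
  have hneg := (hG.congr_ae hH.modification).neg
  have hnegcont : ∀ᵐ ω ∂P, Continuous fun x => -H x ω := hH.continuous.mono fun _ hω => hω.neg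
  obtain ⟨γ, hγ, hγ1, hmean⟩ := hneg.ae_hasMeanWithRate_exp hnegcont hβ hdecay
  filter_upwards [hH.continuous, hmean,
    hneg.ae_exists_exp_le_mul_rpow hHolder hnegcont (half_pos hγ)] with ω hω hmeanω hgrowthω
  refine ⟨fun ε _ => wellPosed_of_continuousOn_of_pos (by fun_prop)
    (fun _ _ => Real.exp_pos _) hf, fun u ubar hu hubar x hx => ?_⟩
  simp only [Real.exp_neg] at hmeanω hgrowthω
  refine tendsto_derivWithin_sub_mul_div hf (A := fun x => Real.exp (H x ω)) (by fun_prop)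
    (fun _ => Real.exp_pos _) (Real.exp_pos _) hγ hγ1 ?_ hgrowthω hu hubar hx
  rwa [← Real.exp_neg, neg_neg]
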